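/- Let $N\ge 1$ be an integer and identify $\mathbb R^2$ with $\mathbb C$. **Definitions.** Let $\mathcal S=\bigcup_{i=1}^N\mathcal S_i\subset\mathbb R^2$. A *family of age $i$* ($1\le i\le N-1$) is a list $\mathcal F=(v_1,v_2;v_3,v_4)$ with $v_1,v_2\in\mathcal S_i$ (the parents, spouses of each other) and $v_3,v_4\in\mathcal S_{i+1}$ (the children, siblings of each other), the four points being distinct and satisfying $v_1+v_2=v_3+v_4$ and $|v_1|^2+|v_2|^2=|v_3|^2+|v_4|^2$ (so they are the vertices of a non-degenerate rectangle). The lists obtained by exchanging $v_1,v_2$ and/or $v_3,v_4$ are regarded as the same family. $\mathcal S$ is a *generation set* if (1) for $1\le i\le N-1$ every $v\in\mathcal S_i$ belongs to exactly one family of age $i$; (2) for $2\le i\le N$ every $v\in\mathcal S_i$ belongs to exactly one family of age $i-1$; (3) for $2\le i\le N-1$ the spouse of any $v\in\mathcal S_i$ is different from its sibling. For $\lambda\in\mathbb Z^{\mathcal S}$ put $|\lambda|=\sum_{v\in\mathcal S}|\lambda_v|$, and let $e_v$ denote the standard basis vectors. For a family put $\lambda^{\mathcal F}=e_{v_1}+e_{v_2}-e_{v_3}-e_{v_4}$.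 The vector $\lambda$ is *resonant* if $\sum_v\lambda_v=0$, $|\lambda|\le 6$, $\sum_v\lambda_v v=0$ and $\sum_v\lambda_v|v|^2=0$; a resonant vector is *of type CF* if it equals $\pm(\lambda^{\mathcal F_1}+\lambda^{\mathcal F_2})$ for two different families $\mathcal F_1\ne\mathcal F_2$. A generation set is *non-degenerate* if every $\lambda\in\mathbb Z^{\mathcal S}$ with $\sum_v\lambda_v=1$, $|\lambda|\le5$ and $\sum_v\lambda_v|v|^2-\big|\sum_v\lambda_v v\big|^2=0$ satisfies one of the following: (i) $|\lambda|=1$; (ii) $|\lambda|=3$, the support of $\lambda$ consists of three distinct members of one family, and the two members with positive coefficient are either its two parents or its two children; (iii) $|\lambda|=5$ and $\lambda=\pm\lambda^{\mathcal F}+e_v$ for some family $\mathcal F$ and some $v\in\mathcal S$; (iv) $|\lambda|=5$ and $\lambda-e_v$ is a resonant vector of type CF for some $v\in\mathcal S$. **The sets $\mathcal S(\mathcal S_1,\vartheta)$.** The members of each generation $k=1,\dots,N$ are labelled by $z\in\{0,1\}^{N-1}$. For $1\le k\le N-1$ there is one abstract family of age $k$ for each choice of the coordinates $z_l$, $l\ne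 k$: its parents are the two members of generation $k$, and its children the two members of generation $k+1$, having these coordinates (and $z_k\in\{0,1\}$). There are $(N-1)2^{N-2}$ abstract families. Let $$\mathcal X=\mathbb R^{2^N}\times\mathbb T^{(N-1)2^{N-2}},\qquad \mathbb T=\mathbb R/2\pi\mathbb Z .$$ A point of $\mathcal X$ consists of the positions of the $2^{N-1}$ members of the first generation and a procreation angle $\vartheta^{\mathcal F}$ for each abstract family. It determines the positions of all other members recursively: if the parents with $z_k=0$ and $z_k=1$ of an abstract family $\mathcal F$ of age $k$ are at $p$ and $q$, then its children with $z_k=0$ and $z_k=1$ are at $$\frac{p+q}2+e^{i\vartheta^{\mathcal F}}\frac{p-q}2\qquad\text{and}\qquad \frac{p+q}2-e^{i\vartheta^{\mathcal F}}\frac{p-q}2$$ respectively. Let $\mathcal S_i$ be the set of positions of the members of generation $i$, and $\mathcal S(\mathcal S_1,\vartheta)=\bigcup_i\mathcal S_i$. **Proposition.** There is a closed set $\mathcal D\subset\mathcal X$ of Lebesgue measure zero such that for every $(\mathcal S_1,\vartheta)\in\mathcal X\setminus\mathcal D$ the $N2^{N-1}$ positions are pairwise distinct and $\mathcal S(\mathcal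 S_1,\vartheta)$ is a non-degenerate generation set. In particular, every nonzero resonant vector for $\mathcal S(\mathcal S_1,\vartheta)$ is equal to $\pm\lambda^{\mathcal F}$ for some family $\mathcal F$ or is of type CF. -/

import Mathlib

noncomputable section

namespace GenSet

/-! ## Families, generation sets and non-degeneracy

The plane is `ℂ`. A configuration of `N` generations is a map `G : Fin N → Set ℂ`; the generations
and the ages of the families are numbered from `0`. -/

/-- A list `(p₁, p₂; c₁, c₂)` of four points of the plane. -/
structure Quad where
  p₁ : ℂ
  p₂ : ℂ
  c₁ : ℂ
  c₂ : ℂ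

namespace Quad

/-- The set of the four points of the list. -/
def points (F : Quad) : Set ℂ := {F.p₁, F.p₂, F.c₁, F.c₂}

/-- `F'` is one of the four trivial permutations of `F`. -/
def TrivialPerm (F F' : Quad) : Prop :=
  F' = ⟨F.p₁, F.p₂, F.c₁, F.c₂⟩ ∨ F' = ⟨F.p₂, F.p₁, F.c₁, F.c₂⟩ ∨
  F' = ⟨F.p₁, F.p₂, F.c₂, F.c₁⟩ ∨ F' = ⟨F.p₂, F.p₁, F.c₂, F.c₁⟩

/-- The integer vector of `F`, with formal sum `p₁ + p₂ - c₁ - c₂`. -/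
def vec (F : Quad) : ℂ →₀ ℤ :=
  Finsupp.single F.p₁ 1 + Finsupp.single F.p₂ 1 - Finsupp.single F.c₁ 1 - Finsupp.single F.c₂ 1

end Quad

variable {N : ℕ}

/-- `F` is a family of age `i`: its points are the vertices of a non-degenerate rectangle (four
distinct points), with the parents `p₁, p₂` (one diagonal) in generation `i` and the children
`c₁, c₂` (the other diagonal) in generation `i + 1`. -/
structure IsFamily (G : Fin N → Set ℂ) (i : ℕ) (F : Quad) : Prop where
  age_lt : i + 1 < N
  parent₁ : F.p₁ ∈ G ⟨i, Nat.lt_of_succ_lt age_lt⟩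
  parent₂ : F.p₂ ∈ G ⟨i, Nat.lt_of_succ_lt age_lt⟩
  child₁ : F.c₁ ∈ G ⟨i + 1, age_lt⟩
  child₂ : F.c₂ ∈ G ⟨i + 1, age_lt⟩
  sum_eq : F.p₁ + F.p₂ = F.c₁ + F.c₂
  sum_sq_eq : ‖F.p₁‖ ^ 2 + ‖F.p₂‖ ^ 2 = ‖F.c₁‖ ^ 2 + ‖F.c₂‖ ^ 2
  nondeg : [F.p₁, F.p₂, F.c₁, F.c₂].Nodup

/-- `v` and `w` are spouses: the two parents of some family. -/
def AreSpouses (G : Fin N → Set ℂ) (v w : ℂ) : Prop :=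
  ∃ i F, IsFamily G i F ∧ F.p₁ = v ∧ F.p₂ = w

/-- `v` and `w` are siblings: the two children of some family. -/
def AreSiblings (G : Fin N → Set ℂ) (v w : ℂ) : Prop :=
  ∃ i F, IsFamily G i F ∧ F.c₁ = v ∧ F.c₂ = w

/-- `v` is a member of one and only one family of age `i`, up to trivial permutations. -/
def UniqueFamily (G : Fin N → Set ℂ) (i : ℕ) (v : ℂ) : Prop :=
  ∃ F, IsFamily G i F ∧ v ∈ F.points ∧
    ∀ F', IsFamily G i F' → v ∈ F'.points → F.TrivialPerm F'

/-- Generation sets: every point outside the last generation is in exactly one family in which its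
generation is that of the parents, every point outside the first generation is in exactly one
family in which its generation is that of the children, and in the intermediate generations the
spouse of a point is never its sibling. -/
structure IsGenerationSet (G : Fin N → Set ℂ) : Prop where
  as_parent : ∀ i : Fin N, (i : ℕ) + 1 < N → ∀ v ∈ G i, UniqueFamily G i v
  as_child : ∀ i : Fin N, 0 < (i : ℕ) → ∀ v ∈ G i, UniqueFamily G ((i : ℕ) - 1) v
  spouse_ne_sibling : ∀ i : Fin N, 0 < (i : ℕ) → (i : ℕ) + 1 < N → ∀ v ∈ G i, ∀ w w',
    AreSpouses G v w → AreSiblings G v w' → w ≠ w'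

/-- The set `𝒮`, union of the generations. -/
def allPoints (G : Fin N → Set ℂ) : Set ℂ := ⋃ i, G i

/-! Integer vectors indexed by `𝒮` are finitely supported functions `ℂ →₀ ℤ` whose support is
contained in `𝒮`. -/

/-- `∑ λᵢ`. -/
def mass (l : ℂ →₀ ℤ) : ℤ := l.sum fun _ a => a

/-- `|λ| = ∑ |λᵢ|`. -/
def size (l : ℂ →₀ ℤ) : ℤ := l.sum fun _ a => |a|

/-- `∑ λᵢ vᵢ`. -/
def momentum (l : ℂ →₀ ℤ) : ℂ := l.sum fun v a => (a : ℂ) * v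

/-- `∑ λᵢ |vᵢ|²`. -/
def energy (l : ℂ →₀ ℤ) : ℝ := l.sum fun v a => (a : ℝ) * ‖v‖ ^ 2

/-- Resonant vectors for `𝒮`. -/
structure IsResonant (G : Fin N → Set ℂ) (l : ℂ →₀ ℤ) : Prop where
  support_subset : (l.support : Set ℂ) ⊆ allPoints G
  mass_eq : mass l = 0
  size_le : size l ≤ 6
  momentum_eq : momentum l = 0
  energy_eq : energy l = 0

/-- `l = ± λ^F` for some family `F`. -/
def IsFamilyVector (G : Fin N → Set ℂ) (l : ℂ →₀ ℤ) : Prop :=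
  ∃ i F, IsFamily G i F ∧ (l = F.vec ∨ l = -F.vec)

/-- Resonant vectors of type CF (couple of families): `± (λ^F₁ + λ^F₂)` with `F₁ ≠ F₂`, where
families that are trivial permutations of each other are the same. -/
def IsCF (G : Fin N → Set ℂ) (l : ℂ →₀ ℤ) : Prop :=
  IsResonant G l ∧ ∃ i j F₁ F₂, IsFamily G i F₁ ∧ IsFamily G j F₂ ∧ ¬ F₁.TrivialPerm F₂ ∧
    (l = F₁.vec + F₂.vec ∨ l = -(F₁.vec + F₂.vec))

/-- `|λ| = 3`, the support of `λ` consists of three distinct members of a family, and the two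
members with a positive coefficient are either the two parents or the two children. -/
def IsThreeOfFamily (G : Fin N → Set ℂ) (l : ℂ →₀ ℤ) : Prop :=
  size l = 3 ∧ ∃ i F, IsFamily G i F ∧ (l.support : Set ℂ) ⊆ F.points ∧ l.support.card = 3 ∧
    ({v | 0 < l v} = {F.p₁, F.p₂} ∨ {v | 0 < l v} = {F.c₁, F.c₂})

/-- Non-degeneracy of a generation set. -/
def IsNonDegenerate (G : Fin N → Set ℂ) : Prop :=
  ∀ l : ℂ →₀ ℤ, (l.support : Set ℂ) ⊆ allPoints G → mass l = 1 → size l ≤ 5 →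
    energy l - ‖momentum l‖ ^ 2 = 0 →
      size l = 1 ∨
      IsThreeOfFamily G l ∨
      (size l = 5 ∧ ∃ m, IsFamilyVector G m ∧ ∃ v ∈ allPoints G, l = m + Finsupp.single v 1) ∨
      (size l = 5 ∧ ∃ v ∈ allPoints G, IsCF G (l - Finsupp.single v 1))

/-! ## The genealogical tree and the placement

In the abstract combinatorial model each generation is a copy of the cube `{false, true}^(N-1)`.
A family of age `k` is an edge of the cube in direction `k`: its parents are the two endpoints of
this edge in generation `k`, its children are the two endpoints in generation `k + 1`. -/

/-- The members of a generation, in the abstract model. -/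
abbrev Label (N : ℕ) : Type := Fin (N - 1) → Bool

/-- The families of the abstract model: an age `k` and the labels in the directions other than
`k`. -/
abbrev FamilyIndex (N : ℕ) : Type := (k : Fin (N - 1)) × ({l : Fin (N - 1) // l ≠ k} → Bool)

theorem card_label (N : ℕ) : Fintype.card (Label N) = 2 ^ (N - 1) := by simp

theorem card_familyIndex (N : ℕ) :
    Fintype.card (FamilyIndex N) = (N - 1) * 2 ^ (N - 2) := by
  simp [Fintype.card_subtype_compl, Nat.sub_sub]

instance two_pi_pos : Fact (0 < 2 * Real.pi) := ⟨Real.two_pi_pos⟩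

/-- The parameter space `𝒳 = ℝ^(2^N) × 𝕋^((N-1) 2^(N-2))`: a point of the plane for each of the
`2^(N-1)` members of the first generation and an angle modulo `2π` for each family. Its measure
`volume` is the product of the Lebesgue measures. -/
abbrev Params (N : ℕ) : Type :=
  (Label N → ℂ) × (FamilyIndex N → AddCircle (2 * Real.pi))

/-- The family of age `k` one of whose edge endpoints is labelled by `z`. -/
def familyOf (k : Fin (N - 1)) (z : Label N) : FamilyIndex N := ⟨k, fun l => z l⟩

/-- The placement of generation `k` in the plane. The first generation is placed freely. If a
family has its parents at `p` and `q` and its procreation angle is `ϑ`, then its children are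
at `(p + q) / 2 ± e^{iϑ} (p - q) / 2`: the diameter joining the children is the diameter joining
the parents, rotated by `ϑ`. -/
def place (x : Params N) : (k : ℕ) → k < N → Label N → ℂ
  | 0, _, z => x.1 z
  | k + 1, h, z =>
    let j : Fin (N - 1) := ⟨k, Nat.lt_sub_of_add_lt h⟩
    let p := place x k (Nat.lt_of_succ_lt h) (Function.update z j false)
    let q := place x k (Nat.lt_of_succ_lt h) (Function.update z j true)
    let e : ℂ := AddCircle.toCircle (x.2 (familyOf j z))
    if z j then (p + q) / 2 - e * ((p - q) / 2) else (p + q) / 2 + e * ((p - q) / 2)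

/-- The position of the member of generation `a.1` labelled by `a.2`. -/
def position (x : Params N) (a : Fin N × Label N) : ℂ := place x a.1 a.1.isLt a.2

/-- The generations of the set `𝒮(𝒮₁, ϑ)` determined by the parameters `x`. -/
def generations (x : Params N) (i : Fin N) : Set ℂ :=
  Set.range fun z : Label N => position x (i, z)

end GenSet

end

/-! Call `energy - |momentum|²` the defect of an integer vector. For fixed coefficients it is a
continuous function of the parameters, real-analytic along lines, so it either vanishes identically
or has a closed null zero set. Only finitely many vectors have size at most 5; the exceptional set
is the union of the zero sets of those of mass one whose defect is not identically zero. Outside it,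
a vector to which the non-degeneracy condition applies has identically zero defect, and it remains
to classify such vectors.

Algebraic half (`exists_familySum_of_defect`): identically zero defect and mass one force `l = e_u +
∑ n_F λ^F`. One peels off the last generation in the support. Rotating the angle of a family `F`
that produces this generation moves only the two children of `F`, with coefficients `α`, `β` say.
The coefficient of `e^{iϑ}` in the defect must vanish; it is `α - β` times the half-difference of
the parents times the conjugate of an analytic function `L`. If `α = β` for every such family,
subtracting multiples of families clears the generation. If not, `L` vanishes identically, the
momentum turns out to be the position of a single child `u`, and `l - e_u` has identically zero
momentum and energy; the same peeling shows that it is a combination of families. In the first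
generation the points are free, and the defect is a quadratic form whose vanishing leaves only unit
vectors.

Combinatorial half (`familySum_cases`, `unitForm_of_eq`): over a fixed label, the coefficients of `∑
n_F λ^F` are the successive increments of the sequence of the `n_F` of the families through that
label, a sequence starting and ending at 0. The size is thus a sum of total variations over the
vertices of the cube, and size at most 6 leaves at most two families, with coefficients `±1` of the
same sign.

Distinctness of the positions, the absence of accidental families and the classification of resonant
vectors all follow by applying this to suitable vectors of mass one. -/

noncomputable section

namespace GenSet

variable {N : ℕ}

/-! ## Zero sets of functions analytic along coordinate lines -/

section ZeroSets

open MeasureTheory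

/-- `g` vanishes identically or its zero set is a null set. -/
def ZeroOrNull {α : Type*} [MeasureSpace α] (g : α → ℂ) : Prop :=
  (∀ x, g x = 0) ∨ volume {x | g x = 0} = 0

/-- The line is connected, so a nonzero analytic function has a discrete zero set, which is null. -/
theorem ZeroOrNull.of_analytic {g : ℝ → ℂ} (hg : AnalyticOnNhd ℝ g Set.univ) : ZeroOrNull g := by
  rcases hg.eqOn_zero_or_eventually_ne_zero_of_preconnected isPreconnected_univ with h | h
  · exact .inl fun x => h (Set.mem_univ x)
  · right
    have h2 := ae_restrict_le_codiscreteWithin (μ := (volume : Measure ℝ)) MeasurableSet.univ h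
    rw [Measure.restrict_univ] at h2
    have h3 : ∀ᵐ x : ℝ, g x ≠ 0 := h2
    simpa [ae_iff] using h3

/-- If `f (a₀, b₀) ≠ 0`, then `f (a, b₀) ≠ 0` for almost every `a`; for each of these the slice at
`a` is not identically zero, so it has a null zero set, and Fubini concludes. Only separate
information in each variable is needed. -/
theorem ZeroOrNull.prod {α β : Type*} [MeasureSpace α] [MeasureSpace β]
    [SigmaFinite (volume : Measure α)] [SigmaFinite (volume : Measure β)] {f : α × β → ℂ}
    (hf : Measurable f) (h₁ : ∀ a, ZeroOrNull fun b => f (a, b))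
    (h₂ : ∀ b, ZeroOrNull fun a => f (a, b)) : ZeroOrNull f := by
  by_cases h : ∀ x, f x = 0
  · exact .inl h
  right
  push Not at h
  obtain ⟨⟨a₀, b₀⟩, h₀⟩ := h
  have hm : MeasurableSet {x | f x = 0} := hf (measurableSet_singleton 0)
  have ha : ∀ᵐ a : α, f (a, b₀) ≠ 0 := by
    rcases h₂ b₀ with h | h
    · exact absurd (h a₀) h₀
    · simpa [ae_iff] using h
  refine (Measure.measure_prod_null hm).2 ?_
  filter_upwards [ha] with a ha
  rcases h₁ a with h | h
  · exact absurd (h b₀) ha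
  · exact h

theorem ZeroOrNull.comp_measurePreserving {α β : Type*} [MeasureSpace α] [MeasureSpace β]
    {f : β → ℂ} (e : α ≃ᵐ β) (he : MeasurePreserving e) (h : ZeroOrNull (f ∘ e)) :
    ZeroOrNull f := by
  rcases h with h | h
  · exact .inl fun x => by simpa using h (e.symm x)
  · right
    have := he.measure_preimage_equiv (f := e) {x | f x = 0}
    rw [← this]
    exact h

theorem ZeroOrNull.pi_fin {X : Type*} [MeasureSpace X] [SigmaFinite (volume : Measure X)] :
    ∀ (n : ℕ) {f : (Fin n → X) → ℂ}, Measurable f →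
      (∀ x i, ZeroOrNull fun t => f (Function.update x i t)) → ZeroOrNull f
  | 0, f, _, _ => by
    by_cases h : f default = 0
    · exact .inl fun x => by rw [Subsingleton.elim x default, h]
    · right
      convert measure_empty (μ := (volume : Measure (Fin 0 → X)))
      ext x
      simpa [Subsingleton.elim x default] using h
  | n + 1, f, hf, h => by
    refine ZeroOrNull.comp_measurePreserving
      (MeasurableEquiv.piFinSuccAbove (fun _ : Fin (n + 1) => X) 0).symm
      ((volume_preserving_piFinSuccAbove (fun _ : Fin (n + 1) => X) 0).symm _) ?_
    refine ZeroOrNull.prod (hf.comp (MeasurableEquiv.measurable _)) (fun a => ?_) fun b => ?_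
    · refine ZeroOrNull.pi_fin n ?_ fun x i => ?_
      · exact (hf.comp (MeasurableEquiv.measurable _)).comp measurable_prodMk_left
      · convert h (Fin.cons a x) i.succ using 3 with t
        simp [MeasurableEquiv.piFinSuccAbove, Fin.insertNthEquiv]
    · by_cases hX : Nonempty X
      · obtain ⟨c⟩ := hX
        convert h (Fin.cons c b) 0 using 3 with t
        simp [MeasurableEquiv.piFinSuccAbove, Fin.insertNthEquiv]
      · exact .inl fun x => absurd ⟨x⟩ hX

theorem ZeroOrNull.pi {ι X : Type*} [Fintype ι] [DecidableEq ι] [MeasureSpace X]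
    [SigmaFinite (volume : Measure X)] {f : (ι → X) → ℂ} (hf : Measurable f)
    (h : ∀ x i, ZeroOrNull fun t => f (Function.update x i t)) : ZeroOrNull f := by
  let e := (Fintype.equivFin ι).symm
  refine ZeroOrNull.comp_measurePreserving (MeasurableEquiv.piCongrLeft (fun _ : ι => X) e)
    (volume_measurePreserving_piCongrLeft (fun _ : ι => X) e) ?_
  refine ZeroOrNull.pi_fin _ (hf.comp (MeasurableEquiv.measurable _)) fun x i => ?_
  convert h (fun j => x (e.symm j)) (e i) using 2
  refine congrArg f (funext fun j => ?_)
  obtain ⟨j, rfl⟩ := e.surjective j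
  simp only [MeasurableEquiv.coe_piCongrLeft, Equiv.piCongrLeft_apply_apply, Function.update_apply,
    e.injective.eq_iff, Equiv.symm_apply_apply]

theorem ZeroOrNull.complex {f : ℂ → ℂ} (hf : Measurable f)
    (h₁ : ∀ a : ℝ, AnalyticOnNhd ℝ (fun b : ℝ => f ⟨a, b⟩) Set.univ)
    (h₂ : ∀ b : ℝ, AnalyticOnNhd ℝ (fun a : ℝ => f ⟨a, b⟩) Set.univ) : ZeroOrNull f := by
  refine ZeroOrNull.comp_measurePreserving Complex.measurableEquivRealProd.symm
    (Complex.volume_preserving_equiv_real_prod.symm _) ?_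
  exact ZeroOrNull.prod (hf.comp (MeasurableEquiv.measurable _))
    (fun a => .of_analytic (h₁ a)) fun b => .of_analytic (h₂ b)

theorem ZeroOrNull.addCircle {f : AddCircle (2 * Real.pi) → ℂ} (hf : Measurable f)
    (h : AnalyticOnNhd ℝ (fun t : ℝ => f t) Set.univ) : ZeroOrNull f := by
  rcases ZeroOrNull.of_analytic h with h | h
  · exact .inl fun x => by
      obtain ⟨t, rfl⟩ := QuotientAddGroup.mk_surjective x
      exact h t
  · right
    have hm : MeasurableSet {x | f x = 0} := hf (measurableSet_singleton 0)
    rw [← (AddCircle.measurePreserving_mk (2 * Real.pi) 0).measure_preimage hm.nullMeasurableSet]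
    -- The measure of the circle is that of one period, and the zeros in one period are among all
    -- the zeros of the lift.
    exact le_antisymm ((Measure.restrict_apply_le _ _).trans h.le) bot_le

/-! ### Functions analytic along lines of the parameter space -/

/-- The point at time `t` of a line in the parameter space. -/
def line (A B : Label N → ℂ) (C D : FamilyIndex N → ℝ) (t : ℝ) : Params N :=
  (fun z => A z + t * B z, fun F => ((C F + t * D F : ℝ) : AddCircle (2 * Real.pi)))

/-- Continuous functions on the parameter space that are analytic along lines. -/
structure LineAnalytic (f : Params N → ℂ) : Prop where
  continuous : Continuous f
  analytic : ∀ A B C D, AnalyticOnNhd ℝ (fun t => f (line A B C D t)) Set.univ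

namespace LineAnalytic

variable {f g : Params N → ℂ}

theorem const (c : ℂ) : LineAnalytic fun _ : Params N => c :=
  ⟨continuous_const, fun _ _ _ _ => analyticOnNhd_const⟩

theorem add (hf : LineAnalytic f) (hg : LineAnalytic g) : LineAnalytic fun x => f x + g x :=
  ⟨hf.1.add hg.1, fun A B C D => (hf.2 A B C D).add (hg.2 A B C D)⟩

theorem sub (hf : LineAnalytic f) (hg : LineAnalytic g) : LineAnalytic fun x => f x - g x :=
  ⟨hf.1.sub hg.1, fun A B C D => (hf.2 A B C D).sub (hg.2 A B C D)⟩

theorem mul (hf : LineAnalytic f) (hg : LineAnalytic g) : LineAnalytic fun x => f x * g x :=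
  ⟨hf.1.mul hg.1, fun A B C D => (hf.2 A B C D).mul (hg.2 A B C D)⟩

/-- Conjugation is only real-linear; this is why lines have a real time and analyticity is over `ℝ`.
-/
theorem star (hf : LineAnalytic f) : LineAnalytic fun x => (starRingEnd ℂ) (f x) :=
  ⟨Complex.continuous_conj.comp hf.1, fun A B C D =>
    (Complex.conjCLE.toContinuousLinearMap.analyticOnNhd Set.univ).comp (hf.2 A B C D)
      (Set.mapsTo_univ _ _)⟩

theorem sum {ι : Type*} (s : Finset ι) {f : ι → Params N → ℂ} (hf : ∀ i, LineAnalytic (f i)) :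
    LineAnalytic fun x => ∑ i ∈ s, f i x :=
  ⟨continuous_finsetSum _ fun i _ => (hf i).1, fun A B C D =>
    Finset.analyticOnNhd_fun_sum _ fun i _ => (hf i).2 A B C D⟩

/-- Each real coordinate line (an angle, or the real or imaginary part of a point) is an instance of
`line`, so the one-variable dichotomy propagates to the product. -/
theorem zeroOrNull (hf : LineAnalytic f) : ZeroOrNull f := by
  classical
  have hlift : ∀ F : FamilyIndex N → AddCircle (2 * Real.pi), ∃ C : FamilyIndex N → ℝ,
      F = fun i => (C i : AddCircle (2 * Real.pi)) := fun F =>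
    ⟨fun i => (QuotientAddGroup.mk_surjective (F i)).choose,
      funext fun i => (QuotientAddGroup.mk_surjective (F i)).choose_spec.symm⟩
  refine ZeroOrNull.prod hf.continuous.measurable (fun a => ?_) fun b => ?_
  · refine ZeroOrNull.pi (hf.continuous.comp (by fun_prop)).measurable fun x i => ?_
    obtain ⟨C, rfl⟩ := hlift x
    refine ZeroOrNull.addCircle (hf.continuous.comp (by fun_prop)).measurable ?_
    convert hf.analytic a 0 (Function.update C i 0) (Pi.single i 1) using 3 with t
    refine Prod.ext (by ext; simp [line]) ?_
    funext j
    by_cases hj : j = i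
    · subst hj; simp [line]
    · simp [line, hj]
  · refine ZeroOrNull.pi (hf.continuous.comp (by fun_prop)).measurable fun x i => ?_
    obtain ⟨C, rfl⟩ := hlift b
    refine ZeroOrNull.complex (hf.continuous.comp (by fun_prop)).measurable (fun s => ?_)
      fun s => ?_
    · convert hf.analytic (Function.update x i s) (Pi.single i Complex.I) C 0 using 3 with t
      refine Prod.ext ?_ (by ext; simp [line])
      funext j
      by_cases hj : j = i
      · subst hj; apply Complex.ext <;> simp [line]
      · simp [line, hj]
    · convert hf.analytic (Function.update x i (s * Complex.I)) (Pi.single i 1) C 0 using 3 with t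
      refine Prod.ext ?_ (by ext; simp [line])
      funext j
      by_cases hj : j = i
      · subst hj; apply Complex.ext <;> simp [line]
      · simp [line, hj]

/-- These functions behave like an integral domain: two null zero sets cannot cover the space, which
has positive measure. -/
theorem eq_zero_or_eq_zero (hf : LineAnalytic f) (hg : LineAnalytic g)
    (h : ∀ x, f x * g x = 0) : (∀ x, f x = 0) ∨ ∀ x, g x = 0 := by
  rcases hf.zeroOrNull with h1 | h1
  · exact .inl h1
  rcases hg.zeroOrNull with h2 | h2
  · exact .inr h2
  have h3 : (volume : Measure (Params N)) Set.univ = 0 := by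
    refine measure_mono_null (fun x _ => ?_) (measure_union_null h1 h2)
    exact mul_eq_zero.1 (h x)
  exact absurd h3 (IsOpen.measure_ne_zero _ isOpen_univ Set.univ_nonempty)

theorem toCircle (F : FamilyIndex N) :
    LineAnalytic fun x : Params N => (AddCircle.toCircle (x.2 F) : ℂ) := by
  refine ⟨by fun_prop, fun A B C D => ?_⟩
  have : (fun t => ((AddCircle.toCircle ((line A B C D t).2 F) : Circle) : ℂ)) =
      fun t : ℝ => Complex.exp (((C F + t * D F : ℝ) : ℂ) * Complex.I) := by
    funext t
    simp only [line, AddCircle.toCircle_apply_mk, Circle.coe_exp]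
    rw [div_self Real.two_pi_pos.ne', one_mul]
  rw [this]
  intro t _
  have : AnalyticAt ℝ (fun t : ℝ => ((C F + t * D F : ℝ) : ℂ)) t :=
    (Complex.ofRealCLM.analyticAt _).fun_comp
      (analyticAt_const.add (analyticAt_id.mul analyticAt_const))
  exact (analyticAt_cexp.restrictScalars).fun_comp (this.mul analyticAt_const)

theorem place : ∀ (k : ℕ) (h : k < N) (z : Label N), LineAnalytic fun x => place x k h z
  | 0, _, z => by
    refine ⟨by simp only [GenSet.place]; fun_prop, fun A B C D => ?_⟩
    simp only [GenSet.place, line]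
    intro t _
    exact analyticAt_const.add ((Complex.ofRealCLM.analyticAt _).mul analyticAt_const)
  | k + 1, h, z => by
    have h1 := fun z => place k (Nat.lt_of_succ_lt h) z
    have h2 := fun F => toCircle (N := N) F
    simp only [GenSet.place, div_eq_mul_inv]
    split_ifs
    · exact (((h1 _).add (h1 _)).mul (const _)).sub
        ((h2 _).mul (((h1 _).sub (h1 _)).mul (const _)))
    · exact (((h1 _).add (h1 _)).mul (const _)).add
        ((h2 _).mul (((h1 _).sub (h1 _)).mul (const _)))

theorem position (a : Fin N × Label N) : LineAnalytic fun x => position x a :=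
  place _ _ _

end LineAnalytic

end ZeroSets

/-! ## Members, families and integer vectors of the abstract model -/

/-- The members of all generations, in the abstract model. -/
abbrev Member (N : ℕ) : Type := Fin N × Label N

namespace FamilyIndex

/-- The generation of the parents. -/
def parentGen (F : FamilyIndex N) : Fin N := ⟨F.1, by have := F.1.isLt; omega⟩

/-- The generation of the children. -/
def childGen (F : FamilyIndex N) : Fin N := ⟨F.1 + 1, by have := F.1.isLt; omega⟩

/-- The labels of the two parents, which are those of the two children. -/
def endpoint (F : FamilyIndex N) (b : Bool) : Label N :=
  fun l => if h : l = F.1 then b else F.2 ⟨l, h⟩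

@[simp]
theorem endpoint_self (F : FamilyIndex N) (b : Bool) : F.endpoint b F.1 = b := by
  simp [endpoint]

@[simp]
theorem familyOf_endpoint (F : FamilyIndex N) (b : Bool) : familyOf F.1 (F.endpoint b) = F := by
  obtain ⟨k, g⟩ := F
  simp only [familyOf, endpoint]
  congr 1
  funext l
  simp [l.2]

theorem update_endpoint (F : FamilyIndex N) (b b' : Bool) :
    Function.update (F.endpoint b) F.1 b' = F.endpoint b' := by
  funext l
  by_cases h : l = F.1
  · subst h; simp
  · simp [endpoint, h]

theorem endpoint_familyOf (k : Fin (N - 1)) (z : Label N) (b : Bool) :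
    FamilyIndex.endpoint (familyOf k z) b = Function.update z k b := by
  funext l
  by_cases h : l = k
  · subst h; simp [endpoint, familyOf]
  · simp [endpoint, familyOf, h]

theorem familyOf_eq_iff (F : FamilyIndex N) (z : Label N) :
    familyOf F.1 z = F ↔ z = F.endpoint false ∨ z = F.endpoint true := by
  constructor
  · intro h
    have : z = F.endpoint (z F.1) := by
      conv_rhs => rw [← h]
      rw [endpoint_familyOf]
      simp [familyOf]
    rcases hz : z F.1
    · exact .inl (hz ▸ this)
    · exact .inr (hz ▸ this)
  · rintro (h | h) <;> rw [h, familyOf_endpoint]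

theorem endpoint_ne (F : FamilyIndex N) : F.endpoint false ≠ F.endpoint true := fun h => by
  simpa using congrFun h F.1

/-- The parent with coordinate `b` in the direction of the family. -/
def parent (F : FamilyIndex N) (b : Bool) : Member N := (F.parentGen, F.endpoint b)

/-- The child with coordinate `b` in the direction of the family. -/
def child (F : FamilyIndex N) (b : Bool) : Member N := (F.childGen, F.endpoint b)

theorem child_ne (F : FamilyIndex N) : F.child false ≠ F.child true := fun h =>
  F.endpoint_ne (congrArg Prod.snd h)

/-- The integer vector of an abstract family. -/
def vec (F : FamilyIndex N) : Member N → ℤ :=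
  Pi.single (F.parent false) 1 + Pi.single (F.parent true) 1 -
    Pi.single (F.child false) 1 - Pi.single (F.child true) 1

/-- The form with indicators lets sums over families be read label by label, as increments of
`height`. -/
theorem vec_apply (F : FamilyIndex N) (a : Member N) :
    F.vec a = (if (a.1 : ℕ) = F.1 ∧ familyOf F.1 a.2 = F then 1 else 0) -
      (if (a.1 : ℕ) = F.1 + 1 ∧ familyOf F.1 a.2 = F then 1 else 0) := by
  obtain ⟨k, z⟩ := a
  have hne := F.endpoint_ne
  simp only [familyOf_eq_iff, vec, Pi.add_apply, Pi.sub_apply, Pi.single_apply, parent, child,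
    Prod.mk.injEq, parentGen, childGen, Fin.ext_iff]
  by_cases h1 : z = F.endpoint false
  · have h2 : z ≠ F.endpoint true := h1 ▸ hne
    simp [h1, hne, sub_eq_add_neg]
  · by_cases h2 : z = F.endpoint true
    · simp [h2, hne.symm]
    · simp [h1, h2]

end FamilyIndex

/-- The combination of the vectors of the families with coefficients `n`. -/
def familySum (n : FamilyIndex N → ℤ) : Member N → ℤ := ∑ F, n F • FamilyIndex.vec F

/-- The coefficient of the family of age `j - 1` containing the label `z`, and `0` if there is no
such family. -/
def height (n : FamilyIndex N → ℤ) (z : Label N) : ℕ → ℤ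
  | 0 => 0
  | j + 1 => if h : j < N - 1 then n (familyOf ⟨j, h⟩ z) else 0

theorem height_eq_sum (n : FamilyIndex N → ℤ) (z : Label N) (j : ℕ) :
    height n z j = ∑ F : FamilyIndex N, n F * if j = F.1 + 1 ∧ familyOf F.1 z = F then 1 else 0 := by
  cases j with
  | zero => simp [height]
  | succ j =>
    simp only [height]
    split_ifs with h
    · rw [Finset.sum_eq_single (familyOf ⟨j, h⟩ z)]
      · simp [familyOf]
      · rintro F - hF
        rw [if_neg, mul_zero]
        rintro ⟨h1, h2⟩
        apply hF
        rw [← h2]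
        congr 1
        ext
        simp only
        omega
      · simp
    · refine (Finset.sum_eq_zero fun F _ => ?_).symm
      rw [if_neg, mul_zero]
      rintro ⟨h1, -⟩
      exact h (by have := F.1.isLt; omega)

/-- A member of generation `k` is a parent in one family of age `k` and a child in one of age `k -
1`. The index shift in `height` and its value 0 outside the range of ages cover the first and last
generations. -/
theorem familySum_apply (n : FamilyIndex N → ℤ) (a : Member N) :
    familySum n a = height n a.2 (a.1 + 1) - height n a.2 a.1 := by
  simp only [height_eq_sum, familySum, Finset.sum_apply, Pi.smul_apply, FamilyIndex.vec_apply,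
    smul_eq_mul, mul_sub, Finset.sum_sub_distrib, add_left_inj]

theorem familySum_add (n m : FamilyIndex N → ℤ) :
    familySum (n + m) = familySum n + familySum m := by
  simp [familySum, add_smul, Finset.sum_add_distrib]

theorem familySum_neg (n : FamilyIndex N → ℤ) : familySum (-n) = -familySum n := by
  simp [familySum]

theorem familySum_single (F : FamilyIndex N) : familySum (Pi.single F 1) = F.vec := by
  simp [familySum, Pi.single_apply]

/-! ## Linear functionals of the integer vectors -/

/-- The functional with the weight `w a` at the member `a`. -/
def weight (w : Member N → ℂ) : (Member N → ℤ) →+ ℂ where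
  toFun l := ∑ a, (l a : ℂ) * w a
  map_zero' := by simp
  map_add' l m := by simp [add_mul, Finset.sum_add_distrib]

theorem weight_apply (w : Member N → ℂ) (l : Member N → ℤ) :
    weight w l = ∑ a, (l a : ℂ) * w a := rfl

@[simp]
theorem weight_single (w : Member N → ℂ) (a : Member N) (c : ℤ) :
    weight w (Pi.single a c) = c * w a := by
  rw [weight_apply, Finset.sum_eq_single a] <;> simp +contextual

theorem weight_congr {w w' : Member N → ℂ} {l : Member N → ℤ}
    (h : ∀ a, l a ≠ 0 → w a = w' a) : weight w l = weight w' l := by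
  refine Finset.sum_congr rfl fun a _ => ?_
  by_cases ha : l a = 0
  · simp [ha]
  · rw [h a ha]

/-- `|v|²` at the position of a member, as a complex number. -/
def sqPosition (x : Params N) (a : Member N) : ℂ :=
  position x a * (starRingEnd ℂ) (position x a)

/-- `∑ λᵢ |vᵢ|² - |∑ λᵢ vᵢ|²`. -/
def defect (x : Params N) (l : Member N → ℤ) : ℂ :=
  weight (sqPosition x) l -
    weight (position x) l * (starRingEnd ℂ) (weight (position x) l)

theorem lineAnalytic_weight_position (l : Member N → ℤ) :
    LineAnalytic fun x => weight (position x) l :=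
  .sum _ fun a => (LineAnalytic.const _).mul (.position a)

theorem lineAnalytic_defect (l : Member N → ℤ) : LineAnalytic fun x => defect x l :=
  LineAnalytic.sub (.sum _ fun a => (LineAnalytic.const _).mul
    ((LineAnalytic.position a).mul (LineAnalytic.position a).star))
    ((lineAnalytic_weight_position l).mul (lineAnalytic_weight_position l).star)

/-! ## Dependence of the positions on the parameters -/

theorem position_child_false (x : Params N) (F : FamilyIndex N) :
    position x (F.child false) = (position x (F.parent false) + position x (F.parent true)) / 2 +
      AddCircle.toCircle (x.2 F) *
        ((position x (F.parent false) - position x (F.parent true)) / 2) := by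
  have h := FamilyIndex.familyOf_endpoint F false
  have h1 := FamilyIndex.update_endpoint F false
  have h2 := FamilyIndex.endpoint_self F false
  simp only [position, FamilyIndex.child, FamilyIndex.childGen, place, FamilyIndex.parent,
    FamilyIndex.parentGen, Fin.eta, h, h1, h2]
  simp

theorem position_child_true (x : Params N) (F : FamilyIndex N) :
    position x (F.child true) = (position x (F.parent false) + position x (F.parent true)) / 2 -
      AddCircle.toCircle (x.2 F) *
        ((position x (F.parent false) - position x (F.parent true)) / 2) := by
  have h := FamilyIndex.familyOf_endpoint F true
  have h1 := FamilyIndex.update_endpoint F true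
  have h2 := FamilyIndex.endpoint_self F true
  simp only [position, FamilyIndex.child, FamilyIndex.childGen, place, FamilyIndex.parent,
    FamilyIndex.parentGen, Fin.eta, h, h1, h2]
  simp

theorem mul_conj_toCircle (t : AddCircle (2 * Real.pi)) :
    (AddCircle.toCircle t : ℂ) * (starRingEnd ℂ) (AddCircle.toCircle t : ℂ) = 1 := by
  rw [Complex.mul_conj, Circle.normSq_coe]; simp

theorem weight_position_vec (x : Params N) (F : FamilyIndex N) :
    weight (position x) F.vec = 0 := by
  simp only [FamilyIndex.vec, map_add, map_sub, weight_single, position_child_false,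
    position_child_true]
  push_cast
  ring

/-- Parallelogram law: `|s + e d|² + |s - e d|²` is the same for every `e` of modulus one. -/
theorem weight_sqPosition_vec (x : Params N) (F : FamilyIndex N) :
    weight (sqPosition x) F.vec = 0 := by
  have h := mul_conj_toCircle (x.2 F)
  simp only [FamilyIndex.vec, map_add, map_sub, weight_single, sqPosition, position_child_false,
    position_child_true, map_mul, map_div₀, map_ofNat]
  push_cast
  linear_combination (-1 / 2 : ℂ) * (position x (F.parent false) - position x (F.parent true)) *
    ((starRingEnd ℂ) (position x (F.parent false)) -
      (starRingEnd ℂ) (position x (F.parent true))) * h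

theorem weight_position_familySum (x : Params N) (n : FamilyIndex N → ℤ) :
    weight (position x) (familySum n) = 0 := by
  simp only [familySum, map_sum, map_zsmul, weight_position_vec, smul_zero, Finset.sum_const_zero]

theorem weight_sqPosition_familySum (x : Params N) (n : FamilyIndex N → ℤ) :
    weight (sqPosition x) (familySum n) = 0 := by
  simp only [familySum, map_sum, map_zsmul, weight_sqPosition_vec, smul_zero, Finset.sum_const_zero]

/-! ### Changing one angle, and setting all angles to zero -/

/-- The parameters with one angle changed. -/
def setAngle (x : Params N) (F : FamilyIndex N) (t : AddCircle (2 * Real.pi)) : Params N :=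
  (x.1, Function.update x.2 F t)

/-- Positions in generation `k` involve only the angles of families of age below `k`. -/
theorem place_setAngle_of_le (x : Params N) (F : FamilyIndex N) (t : AddCircle (2 * Real.pi)) :
    ∀ (k : ℕ) (h : k < N) (z : Label N), k ≤ F.1 → place (setAngle x F t) k h z = place x k h z
  | 0, _, z, _ => by simp [place, setAngle]
  | k + 1, h, z, hk => by
    have ih := fun z => place_setAngle_of_le x F t k (Nat.lt_of_succ_lt h) z (by omega)
    have hF : familyOf ⟨k, Nat.lt_sub_of_add_lt h⟩ z ≠ F := by
      rintro rfl
      simp [familyOf] at hk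
    simp only [place, ih]
    simp [setAngle, hF]

theorem position_setAngle (x : Params N) (F : FamilyIndex N) (t : AddCircle (2 * Real.pi))
    (a : Member N) (ha : (a.1 : ℕ) ≤ F.1 + 1) (h1 : a ≠ F.child false) (h2 : a ≠ F.child true) :
    position (setAngle x F t) a = position x a := by
  obtain ⟨⟨k, hk⟩, z⟩ := a
  simp only [position]
  rcases Nat.lt_or_ge F.1 k with h | h
  · obtain rfl : k = F.1 + 1 := le_antisymm ha h
    have ih := fun z => place_setAngle_of_le x F t F.1 (Nat.lt_of_succ_lt hk) z le_rfl
    have hF : familyOf ⟨F.1, Nat.lt_sub_of_add_lt hk⟩ z ≠ F := by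
      intro h
      rcases (FamilyIndex.familyOf_eq_iff F z).1 h with h | h
      · exact h1 (Prod.ext rfl h)
      · exact h2 (Prod.ext rfl h)
    simp only [place, ih]
    simp [setAngle, hF]
  · exact place_setAngle_of_le x F t k hk z h

/-- Without rotation each child lands on the parent with its label. At these parameters a vector is
seen only through its sums over each label. -/
theorem place_zero_angle (y : Label N → ℂ) :
    ∀ (k : ℕ) (h : k < N) (z : Label N), place (y, 0) k h z = y z
  | 0, _, z => rfl
  | k + 1, h, z => by
    simp only [place, place_zero_angle y k]
    set j : Fin (N - 1) := ⟨k, Nat.lt_sub_of_add_lt h⟩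
    have h3 : z = Function.update z j (z j) := by simp
    have h2 : ((AddCircle.toCircle (0 : AddCircle (2 * Real.pi)) : Circle) : ℂ) = 1 := by simp
    split_ifs with h1
    · rw [h1] at h3
      simp only [Pi.zero_apply, h2, ← h3]; ring
    · rw [Bool.not_eq_true] at h1
      rw [h1] at h3
      simp only [Pi.zero_apply, h2, ← h3]; ring

theorem position_zero_angle (y : Label N → ℂ) (a : Member N) : position (y, 0) a = y a.2 :=
  place_zero_angle y _ _ _

/-- The sum of the coefficients of the members with a given label. -/
def labelSum (l : Member N → ℤ) (z : Label N) : ℤ := ∑ k, l (k, z)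

theorem weight_of_label (g : Label N → ℂ) (l : Member N → ℤ) :
    weight (fun a => g a.2) l = ∑ z, (labelSum l z : ℂ) * g z := by
  simp [weight_apply, Fintype.sum_prod_type_right, labelSum, Finset.sum_mul]

theorem weight_position_zero_angle (y : Label N → ℂ) (l : Member N → ℤ) :
    weight (position (y, 0)) l = ∑ z, (labelSum l z : ℂ) * y z := by
  rw [← weight_of_label]
  exact weight_congr fun a _ => position_zero_angle y a

theorem weight_sqPosition_zero_angle (y : Label N → ℂ) (l : Member N → ℤ) :
    weight (sqPosition (y, 0)) l = ∑ z, (labelSum l z : ℂ) * (y z * (starRingEnd ℂ) (y z)) := by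
  rw [← weight_of_label (fun z => y z * (starRingEnd ℂ) (y z))]
  exact weight_congr fun a _ => by rw [sqPosition, position_zero_angle]

theorem labelSum_of_supported {l : Member N → ℤ} (h : ∀ a : Member N, 0 < (a.1 : ℕ) → l a = 0)
    (k : Fin N) (hk : (k : ℕ) = 0) (z : Label N) : labelSum l z = l (k, z) := by
  rw [labelSum, Finset.sum_eq_single k]
  · intro j _ hj
    exact h _ (Nat.pos_of_ne_zero fun h0 => hj (Fin.ext (h0.trans hk.symm)))
  · simp

/-! ## Vectors whose defect vanishes identically -/

theorem exists_toCircle_eq {u : ℂ} (hu : ‖u‖ = 1) :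
    ∃ t : AddCircle (2 * Real.pi), (AddCircle.toCircle t : ℂ) = u := by
  refine ⟨((Complex.arg u : ℝ) : AddCircle (2 * Real.pi)), ?_⟩
  rw [AddCircle.toCircle_apply_mk, div_self Real.two_pi_pos.ne', one_mul, Circle.coe_exp]
  simpa [hu] using Complex.norm_mul_exp_arg_mul_I u

/-- A Fourier coefficient of a trigonometric polynomial of degree one, extracted by averaging over
the four points `±1`, `±I`. -/
theorem coeff_eq_zero_of_forall_toCircle {A B C : ℂ}
    (h : ∀ t : AddCircle (2 * Real.pi), A + AddCircle.toCircle t * B +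
      (starRingEnd ℂ) (AddCircle.toCircle t : ℂ) * C = 0) : B = 0 := by
  have key : ∀ u : ℂ, ‖u‖ = 1 → A + u * B + (starRingEnd ℂ) u * C = 0 := fun u hu => by
    obtain ⟨t, rfl⟩ := exists_toCircle_eq hu
    exact h t
  have h1 := key 1 (by simp)
  have h2 := key (-1) (by simp)
  have h3 := key Complex.I (by simp)
  have h4 := key (-Complex.I) (by simp)
  simp only [map_one, map_neg, Complex.conj_I] at h1 h2 h3 h4
  linear_combination (1 / 4 : ℂ) * (h1 - h2) - Complex.I / 4 * (h3 - h4) +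
    (B - C) / 2 * (Complex.I_mul_I)

/-- The part of `l` off the children of `F`. -/
def offChildren (F : FamilyIndex N) (l : Member N → ℤ) : Member N → ℤ :=
  l - Pi.single (F.child false) (l (F.child false)) - Pi.single (F.child true) (l (F.child true))

theorem weight_eq_offChildren (F : FamilyIndex N) (l : Member N → ℤ) (w : Member N → ℂ) :
    weight w l = weight w (offChildren F l) + l (F.child false) * w (F.child false) +
      l (F.child true) * w (F.child true) := by
  simp only [offChildren, map_sub, weight_single]
  ring

theorem offChildren_ne_zero {F : FamilyIndex N} {l : Member N → ℤ} {a : Member N}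
    (h : offChildren F l a ≠ 0) : l a ≠ 0 ∧ a ≠ F.child false ∧ a ≠ F.child true := by
  have hne := F.child_ne
  refine ⟨?_, ?_, ?_⟩ <;> rintro h0 <;> apply h
  · have h1 : a = F.child false → l (F.child false) = 0 := fun h => h ▸ h0
    have h2 : a = F.child true → l (F.child true) = 0 := fun h => h ▸ h0
    simp only [offChildren, Pi.sub_apply, Pi.single_apply, h0]
    split_ifs <;> simp_all
  · subst h0; simp [offChildren, hne]
  · subst h0; simp [offChildren, hne.symm]

/-! ### Rotating a family that ends in the last generation of the support -/

/-- No member of a generation after `m` is in the support of `l`. -/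
def SupportedUpTo (m : ℕ) (l : Member N → ℤ) : Prop := ∀ a : Member N, m < (a.1 : ℕ) → l a = 0

theorem SupportedUpTo.position_setAngle {F : FamilyIndex N} {l : Member N → ℤ}
    (hl : SupportedUpTo (F.1 + 1) l) (x : Params N) (t : AddCircle (2 * Real.pi)) (a : Member N)
    (ha : offChildren F l a ≠ 0) : position (setAngle x F t) a = position x a := by
  obtain ⟨h1, h2, h3⟩ := offChildren_ne_zero ha
  exact GenSet.position_setAngle x F t a (not_lt.1 fun h => h1 (hl a h)) h2 h3

/-- The midpoint of the parents. -/
def midpoint (x : Params N) (F : FamilyIndex N) : ℂ :=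
  (position x (F.parent false) + position x (F.parent true)) / 2

/-- Half of the difference of the parents. -/
def halfDiff (x : Params N) (F : FamilyIndex N) : ℂ :=
  (position x (F.parent false) - position x (F.parent true)) / 2

theorem lineAnalytic_midpoint (F : FamilyIndex N) : LineAnalytic fun x => midpoint x F := by
  simp only [midpoint, div_eq_mul_inv]
  exact ((LineAnalytic.position _).add (.position _)).mul (.const _)

theorem lineAnalytic_halfDiff (F : FamilyIndex N) : LineAnalytic fun x => halfDiff x F := by
  simp only [halfDiff, div_eq_mul_inv]
  exact ((LineAnalytic.position _).sub (.position _)).mul (.const _)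

theorem midpoint_zero_angle (F : FamilyIndex N) :
    midpoint (Pi.single (F.endpoint false) 1, 0) F = 1 / 2 := by
  simp [midpoint, position_zero_angle, FamilyIndex.parent, F.endpoint_ne.symm]

theorem halfDiff_zero_angle (F : FamilyIndex N) :
    halfDiff (Pi.single (F.endpoint false) 1, 0) F = 1 / 2 := by
  simp [halfDiff, position_zero_angle, FamilyIndex.parent, F.endpoint_ne.symm]

theorem position_parent_setAngle (x : Params N) (F : FamilyIndex N) (t : AddCircle (2 * Real.pi))
    (b : Bool) : position (setAngle x F t) (F.parent b) = position x (F.parent b) :=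
  place_setAngle_of_le x F t _ _ _ le_rfl

theorem position_child_false_setAngle (x : Params N) (F : FamilyIndex N)
    (t : AddCircle (2 * Real.pi)) : position (setAngle x F t) (F.child false) =
      midpoint x F + AddCircle.toCircle t * halfDiff x F := by
  rw [position_child_false, position_parent_setAngle, position_parent_setAngle, midpoint, halfDiff]
  simp [setAngle]

theorem position_child_true_setAngle (x : Params N) (F : FamilyIndex N)
    (t : AddCircle (2 * Real.pi)) : position (setAngle x F t) (F.child true) =
      midpoint x F - AddCircle.toCircle t * halfDiff x F := by
  rw [position_child_true, position_parent_setAngle, position_parent_setAngle, midpoint, halfDiff]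
  simp [setAngle]

theorem weight_position_setAngle {F : FamilyIndex N} {l : Member N → ℤ}
    (hl : SupportedUpTo (F.1 + 1) l) (x : Params N) (t : AddCircle (2 * Real.pi)) :
    weight (position (setAngle x F t)) l = weight (position x) (offChildren F l) +
      l (F.child false) * (midpoint x F + AddCircle.toCircle t * halfDiff x F) +
      l (F.child true) * (midpoint x F - AddCircle.toCircle t * halfDiff x F) := by
  rw [weight_eq_offChildren F, weight_congr (hl.position_setAngle x t),
    position_child_false_setAngle, position_child_true_setAngle]

theorem weight_sqPosition_setAngle {F : FamilyIndex N} {l : Member N → ℤ}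
    (hl : SupportedUpTo (F.1 + 1) l) (x : Params N) (t : AddCircle (2 * Real.pi)) :
    weight (sqPosition (setAngle x F t)) l = weight (sqPosition x) (offChildren F l) +
      l (F.child false) * ((midpoint x F + AddCircle.toCircle t * halfDiff x F) *
        (starRingEnd ℂ) (midpoint x F + AddCircle.toCircle t * halfDiff x F)) +
      l (F.child true) * ((midpoint x F - AddCircle.toCircle t * halfDiff x F) *
        (starRingEnd ℂ) (midpoint x F - AddCircle.toCircle t * halfDiff x F)) := by
  have h : ∀ a, offChildren F l a ≠ 0 → sqPosition (setAngle x F t) a = sqPosition x a :=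
    fun a ha => by rw [sqPosition, hl.position_setAngle x t a ha, sqPosition]
  rw [weight_eq_offChildren F, weight_congr h, sqPosition, sqPosition,
    position_child_false_setAngle, position_child_true_setAngle]

/-- Momentum and energy of `l` vanish for all parameters. -/
structure IdenticallyResonant (l : Member N → ℤ) : Prop where
  momentum : ∀ x : Params N, weight (position x) l = 0
  energy : ∀ x : Params N, weight (sqPosition x) l = 0

/-- The coefficient of `e^{iϑ}` in the energy is the difference of the two child coefficients times
`d * conj s`, with `s` the midpoint and `d` the half-difference of the parents. -/
theorem IdenticallyResonant.eq_children {F : FamilyIndex N} {l : Member N → ℤ}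
    (h : IdenticallyResonant l) (hl : SupportedUpTo (F.1 + 1) l) :
    l (F.child false) = l (F.child true) := by
  -- At these parameters `s = d = 1/2`, so the coefficient of `e^{iϑ}` is a quarter of the
  -- difference.
  let x : Params N := (Pi.single (F.endpoint false) 1, 0)
  have h1 := halfDiff_zero_angle F
  have h2 := midpoint_zero_angle F
  have key : ((l (F.child false) : ℂ) - l (F.child true)) * (1 / 4) = 0 := by
    refine coeff_eq_zero_of_forall_toCircle
      (A := weight (sqPosition x) (offChildren F l) +
        (l (F.child false) + l (F.child true)) * (1 / 2))
      (C := ((l (F.child false) : ℂ) - l (F.child true)) * (1 / 4)) fun t => ?_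
    have h3 := h.energy (setAngle x F t)
    have h4 := mul_conj_toCircle t
    rw [weight_sqPosition_setAngle hl, h1, h2] at h3
    simp only [map_add, map_sub, map_mul, map_div₀, map_one, map_ofNat] at h3
    linear_combination h3 - ((l (F.child false) : ℂ) + l (F.child true)) / 4 * h4
  have : (l (F.child false) : ℂ) = l (F.child true) := by linear_combination 4 * key
  exact_mod_cast this

/-- When the children have different coefficients, the part of the momentum not involving the angle
must equal the midpoint of the parents. The whole momentum is then `s + (α - β) e^{iϑ} d`, an affine
combination of the two children. -/
theorem eq_children_or_momentum_of_defect {F : FamilyIndex N} {l : Member N → ℤ}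
    (h : ∀ x, defect x l = 0) (hl : SupportedUpTo (F.1 + 1) l) :
    l (F.child false) = l (F.child true) ∨ ∀ x, 2 * weight (position x) l =
      (1 + (l (F.child false) - l (F.child true))) * position x (F.child false) +
      (1 - (l (F.child false) - l (F.child true))) * position x (F.child true) := by
  by_cases h0 : l (F.child false) = l (F.child true)
  · exact .inl h0
  right
  have h0' : (l (F.child false) : ℂ) - l (F.child true) ≠ 0 := by
    rw [sub_ne_zero]; exact_mod_cast h0
  set α := (l (F.child false) : ℂ)
  set β := (l (F.child true) : ℂ)
  -- `L` is the midpoint minus the angle-free part of the momentum; the coefficient of `e^{iϑ}` in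
  -- the defect is `(α - β) * d * conj L`.
  let L : Params N → ℂ := fun x =>
    midpoint x F - weight (position x) (offChildren F l) - (α + β) * midpoint x F
  have hL : LineAnalytic L := ((lineAnalytic_midpoint F).sub (lineAnalytic_weight_position _)).sub
    ((LineAnalytic.const _).mul (lineAnalytic_midpoint F))
  have hprod : ∀ x, halfDiff x F * (starRingEnd ℂ) (L x) = 0 := fun x => by
    suffices (α - β) * (halfDiff x F * (starRingEnd ℂ) (L x)) = 0 from
      (mul_eq_zero.1 this).resolve_left h0'
    set W := weight (position x) (offChildren F l)
    set s := midpoint x F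
    set d := halfDiff x F
    refine coeff_eq_zero_of_forall_toCircle
      (A := weight (sqPosition x) (offChildren F l) +
        (α + β) * (s * (starRingEnd ℂ) s + d * (starRingEnd ℂ) d) -
        (W + (α + β) * s) * (starRingEnd ℂ) (W + (α + β) * s) -
        (α - β) ^ 2 * (d * (starRingEnd ℂ) d))
      (C := (α - β) * ((starRingEnd ℂ) d * L x)) fun t => ?_
    have h3 := h (setAngle x F t)
    have h4 := mul_conj_toCircle t
    have hα : (starRingEnd ℂ) α = α := by simp [α]
    have hβ : (starRingEnd ℂ) β = β := by simp [β]
    rw [defect, weight_sqPosition_setAngle hl, weight_position_setAngle hl] at h3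
    simp only [L, map_add, map_sub, map_mul, map_intCast, hα, hβ] at h3 ⊢
    linear_combination h3 - ((α + β) - (α - β) ^ 2) * d * (starRingEnd ℂ) d * h4
  rcases (lineAnalytic_halfDiff F).eq_zero_or_eq_zero hL.star hprod with h1 | h1
  · have := h1 (Pi.single (F.endpoint false) 1, 0)
    rw [halfDiff_zero_angle] at this
    norm_num at this
  · intro x
    have h2 : L x = 0 := by simpa using h1 x
    have h3 := weight_eq_offChildren F l (position x)
    simp only [L] at h2
    rw [h3, position_child_false, position_child_true]
    rw [midpoint] at h2
    linear_combination (-2 : ℂ) * h2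

/-- With zero angles, put the label `z` at 1 and all others at 0: for the label sum `S` the defect
is `S - S²`. -/
theorem sq_labelSum_of_defect {l : Member N → ℤ} (h : ∀ x, defect x l = 0) (z : Label N) :
    (labelSum l z : ℂ) * labelSum l z = labelSum l z := by
  have h1 := h (Pi.single z 1, 0)
  rw [defect, weight_position_zero_angle, weight_sqPosition_zero_angle] at h1
  simp [Pi.single_apply] at h1
  linear_combination -h1

/-- Put both labels at 1: `(S + S') - (S + S')² = 0`, and idempotency of `S` and `S'` leaves `2 S S'
= 0`. -/
theorem labelSum_mul_labelSum_of_defect {l : Member N → ℤ} (h : ∀ x, defect x l = 0)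
    {z z' : Label N} (hz : z ≠ z') : labelSum l z * labelSum l z' = 0 := by
  have h1 := h (Pi.single z 1 + Pi.single z' 1, 0)
  rw [defect, weight_position_zero_angle, weight_sqPosition_zero_angle] at h1
  have e1 : ∑ w, (labelSum l w : ℂ) * (Pi.single z 1 + Pi.single z' 1 : Label N → ℂ) w =
      labelSum l z + labelSum l z' := by
    simp [Pi.single_apply, mul_add, Finset.sum_add_distrib]
  have e2 : ∑ w, (labelSum l w : ℂ) * ((Pi.single z 1 + Pi.single z' 1 : Label N → ℂ) w *
      (starRingEnd ℂ) ((Pi.single z 1 + Pi.single z' 1 : Label N → ℂ) w)) =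
      labelSum l z + labelSum l z' := by
    rw [← e1]
    refine Finset.sum_congr rfl fun w _ => ?_
    congr 1
    simp only [Pi.add_apply, Pi.single_apply]
    by_cases h1 : w = z
    · simp [h1, hz]
    · by_cases h2 : w = z' <;> simp [h1, h2, hz.symm]
  rw [e1, e2] at h1
  simp only [map_add, map_intCast] at h1
  have : (labelSum l z : ℂ) * labelSum l z' = 0 := by
    linear_combination (-1 / 2 : ℂ) * (h1 + sq_labelSum_of_defect h z + sq_labelSum_of_defect h z')
  exact_mod_cast this

theorem labelSum_eq_zero_of_resonant {l : Member N → ℤ} (h : IdenticallyResonant l)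
    (z : Label N) : labelSum l z = 0 := by
  have h1 := h.momentum (Pi.single z 1, 0)
  rw [weight_position_zero_angle] at h1
  simpa [Pi.single_apply] using h1

/-- Subtracting families of age `m` removes generation `m + 1`, if siblings of that generation
have equal coefficients. -/
theorem exists_supportedUpTo_of_eq_children {m : ℕ} {l : Member N → ℤ}
    (hl : SupportedUpTo (m + 1) l)
    (h : ∀ F : FamilyIndex N, (F.1 : ℕ) = m → l (F.child false) = l (F.child true)) :
    ∃ n : FamilyIndex N → ℤ, SupportedUpTo m (l - familySum n) := by
  -- The sign is negative because children carry `-1` in `F.vec`.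
  refine ⟨fun F => if (F.1 : ℕ) = m then -l (F.child false) else 0, fun a ha => ?_⟩
  obtain ⟨⟨k, hk⟩, z⟩ := a
  simp only at ha
  obtain ⟨k, rfl⟩ : ∃ k', k = k' + 1 := ⟨k - 1, by omega⟩
  have hk' : k < N - 1 := by omega
  rw [Pi.sub_apply, familySum_apply]
  simp only [height, hk', dite_true]
  rcases Nat.lt_or_ge m k with h1 | h1
  · rw [hl _ (by simpa using h1)]
    have h2 : k + 1 ≠ m := by omega
    simp [familyOf, h1.ne', h2]
  · obtain rfl : k = m := by omega
    have e : l (⟨k + 1, hk⟩, z) = l (FamilyIndex.child (familyOf ⟨k, hk'⟩ z) false) := by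
      rcases (FamilyIndex.familyOf_eq_iff (familyOf ⟨k, hk'⟩ z) z).1 rfl with h2 | h2
      · conv_lhs => rw [h2]
        rfl
      · rw [h _ rfl]
        conv_lhs => rw [h2]
        rfl
    simp [familyOf] at e ⊢
    rw [e]; simp

theorem IdenticallyResonant.sub_familySum {l : Member N → ℤ} (h : IdenticallyResonant l)
    (n : FamilyIndex N → ℤ) : IdenticallyResonant (l - familySum n) :=
  ⟨fun x => by rw [map_sub, h.momentum, weight_position_familySum, sub_zero],
    fun x => by rw [map_sub, h.energy, weight_sqPosition_familySum, sub_zero]⟩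

theorem defect_sub_familySum (l : Member N → ℤ) (n : FamilyIndex N → ℤ) (x : Params N) :
    defect x (l - familySum n) = defect x l := by
  rw [defect, map_sub, map_sub, weight_position_familySum, weight_sqPosition_familySum, sub_zero,
    sub_zero, defect]

/-- Generations are peeled off from the last one; a vector left on the freely placed first
generation with identically zero momentum is 0. -/
theorem IdenticallyResonant.exists_of_supportedUpTo :
    ∀ (m : ℕ) {l : Member N → ℤ}, IdenticallyResonant l → SupportedUpTo m l →
      ∃ n, l = familySum n
  | 0, l, h, hl => by
    refine ⟨0, ?_⟩
    funext a
    rcases Nat.eq_zero_or_pos (a.1 : ℕ) with h0 | h0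
    · have := labelSum_of_supported hl a.1 h0 a.2
      rw [labelSum_eq_zero_of_resonant h] at this
      simp [familySum, ← this]
    · simp [familySum, hl a h0]
  | m + 1, l, h, hl => by
    obtain ⟨n, hn⟩ := exists_supportedUpTo_of_eq_children hl fun F hF =>
      h.eq_children (hF ▸ hl)
    obtain ⟨n', hn'⟩ := exists_of_supportedUpTo m (h.sub_familySum n) hn
    exact ⟨n' + n, by rw [familySum_add, ← hn', sub_add_cancel]⟩

theorem supportedUpTo_card (l : Member N → ℤ) : SupportedUpTo N l :=
  fun a ha => absurd a.1.isLt (by omega)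

/-- Peeling again, except that siblings may now have different coefficients. The assumption on label
sums excludes `l` being a combination of families alone; it survives the subtraction of families,
unlike a statement about individual coefficients. -/
theorem exists_familySum_of_defect_of_supportedUpTo :
    ∀ (m : ℕ) {l : Member N → ℤ}, (∀ x, defect x l = 0) → (∃ z, labelSum l z ≠ 0) →
      SupportedUpTo m l → ∃ u n, l = Pi.single u 1 + familySum n
  | 0, l, h, ⟨z, hz⟩, hl => by
    have h1 : labelSum l z = 1 := by
      have := sq_labelSum_of_defect h z
      have h2 : labelSum l z * labelSum l z = labelSum l z := by exact_mod_cast this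
      exact mul_left_cancel₀ hz (by rw [h2, mul_one])
    obtain ⟨k, hk⟩ : ∃ k : Fin N, l (k, z) ≠ 0 := by
      by_contra! h3
      exact hz (by simp [labelSum, h3])
    have hk0 : (k : ℕ) = 0 := by
      by_contra h4
      exact hk (hl _ (Nat.pos_of_ne_zero h4))
    -- In the first generation the coefficients are the label sums: idempotent, with pairwise
    -- products zero, and one of them is nonzero.
    refine ⟨(k, z), 0, ?_⟩
    rw [show familySum (0 : FamilyIndex N → ℤ) = 0 by simp [familySum], add_zero]
    funext a
    rcases Nat.eq_zero_or_pos (a.1 : ℕ) with h0 | h0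
    · obtain ⟨k', z'⟩ := a
      obtain rfl : k' = k := Fin.ext (h0.trans hk0.symm)
      rw [← labelSum_of_supported hl k' h0 z']
      by_cases hzz : z = z'
      · subst hzz; simp [h1]
      · have := labelSum_mul_labelSum_of_defect h hzz
        rw [h1, one_mul] at this
        rw [this, Pi.single_eq_of_ne]
        simpa using Ne.symm hzz
    · rw [hl a h0, Pi.single_eq_of_ne]
      rintro rfl
      exact h0.ne' hk0
  | m + 1, l, h, hz, hl => by
    by_cases hF : ∀ F : FamilyIndex N, (F.1 : ℕ) = m → l (F.child false) = l (F.child true)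
    · obtain ⟨n, hn⟩ := exists_supportedUpTo_of_eq_children hl hF
      -- A label sum is a momentum at special parameters, and families have zero momentum.
      have hlabel : ∀ z, labelSum (l - familySum n) z = labelSum l z := fun z => by
        have h1 := weight_position_zero_angle (Pi.single z 1) (l - familySum n)
        have h2 := weight_position_zero_angle (Pi.single z 1) l
        rw [map_sub, weight_position_familySum, sub_zero, h2] at h1
        simpa [Pi.single_apply] using h1.symm
      obtain ⟨u, n', hn'⟩ := exists_familySum_of_defect_of_supportedUpTo m
        (fun x => (defect_sub_familySum l n x).trans (h x)) (by simpa only [hlabel] using hz) hn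
      exact ⟨u, n' + n, by rw [familySum_add, ← add_assoc, ← hn', sub_add_cancel]⟩
    · push Not at hF
      obtain ⟨F, hFm, hF⟩ := hF
      have hmom := (eq_children_or_momentum_of_defect h (F := F) (hFm ▸ hl)).resolve_left hF
      set δ : ℂ := l (F.child false) - l (F.child true) with hδ
      -- With zero angles and one parent label of `F` at 1, the momentum formula says that the label
      -- sum is `(1 + δ) / 2`; idempotency gives `δ² = 1`.
      have h1 : δ = 1 ∨ δ = -1 := by
        have e := hmom (Pi.single (F.endpoint false) 1, 0)
        have e2 := sq_labelSum_of_defect h (F.endpoint false)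
        rw [weight_position_zero_angle, position_zero_angle, position_zero_angle] at e
        simp [Pi.single_apply, FamilyIndex.child, F.endpoint_ne.symm] at e
        have e3 : (δ - 1) * (δ + 1) = 0 := by
          linear_combination 4 * e2 - (1 + δ + 2 * (labelSum l (F.endpoint false) : ℂ) - 2) * e
        rcases mul_eq_zero.1 e3 with e4 | e4
        · exact .inl (sub_eq_zero.1 e4)
        · exact .inr (eq_neg_of_add_eq_zero_left e4)
      obtain ⟨u, hu⟩ : ∃ u : Member N, ∀ x, weight (position x) l = position x u := by
        rcases h1 with h1 | h1
        · refine ⟨F.child false, fun x => ?_⟩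
          have := hmom x
          rw [h1] at this
          linear_combination this / 2
        · refine ⟨F.child true, fun x => ?_⟩
          have := hmom x
          rw [h1] at this
          linear_combination this / 2
      -- Since the momentum is the position of `u`, zero defect says that the energy is its squared
      -- modulus.
      have hres : IdenticallyResonant (l - Pi.single u 1) := by
        refine ⟨fun x => ?_, fun x => ?_⟩
        · rw [map_sub, weight_single, hu]; simp
        · have := h x
          rw [defect, hu] at this
          rw [map_sub, weight_single, sqPosition]
          push_cast
          linear_combination this
      obtain ⟨n, hn⟩ := hres.exists_of_supportedUpTo N (supportedUpTo_card _)
      exact ⟨u, n, by rw [← hn, add_sub_cancel]⟩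

theorem exists_familySum_of_defect {l : Member N → ℤ} (h : ∀ x, defect x l = 0)
    (hl : ∑ a, l a = 1) : ∃ u n, l = Pi.single u 1 + familySum n := by
  refine exists_familySum_of_defect_of_supportedUpTo N h ?_ (supportedUpTo_card _)
  by_contra! h0
  rw [Fintype.sum_prod_type_right] at hl
  exact zero_ne_one ((Finset.sum_eq_zero fun z _ => h0 z).symm.trans hl)

/-! ## Short combinations of families -/

/-- `|λ|` for the vectors of the abstract model. -/
def absSize (l : Member N → ℤ) : ℤ := ∑ a, |l a|

namespace FamilyIndex

/-- The labels of the members of a family. -/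
def ends (F : FamilyIndex N) : Finset (Label N) := {F.endpoint false, F.endpoint true}

theorem mem_ends {F : FamilyIndex N} {z : Label N} : z ∈ F.ends ↔ familyOf F.1 z = F := by
  rw [familyOf_eq_iff, ends, Finset.mem_insert, Finset.mem_singleton]

theorem card_ends (F : FamilyIndex N) : F.ends.card = 2 := Finset.card_pair F.endpoint_ne

/-- Two distinct vertices lie on at most one edge of the cube: the coordinate in which they differ
is its direction, and the others are its label. -/
theorem eq_of_mem_ends {F F' : FamilyIndex N} {z z' : Label N} (hz : z ≠ z') (h1 : z ∈ F.ends)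
    (h2 : z' ∈ F.ends) (h3 : z ∈ F'.ends) (h4 : z' ∈ F'.ends) : F = F' := by
  have key : ∀ {G : FamilyIndex N} {i}, z i ≠ z' i → z ∈ G.ends → z' ∈ G.ends → i = G.1 := by
    rintro ⟨k, g⟩ i hi h h'
    by_contra hik
    have e : familyOf k z = familyOf k z' := (mem_ends.1 h).trans (mem_ends.1 h').symm
    simp only [familyOf, Sigma.mk.injEq, heq_eq_eq, true_and] at e
    exact hi (congrFun e ⟨i, hik⟩)
  obtain ⟨i, hi⟩ := Function.ne_iff.1 hz
  rw [← mem_ends.1 h1, ← mem_ends.1 h3, ← key hi h1 h2, ← key hi h3 h4]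

theorem three_le_card_union {F F' : FamilyIndex N} (h : F ≠ F') :
    3 ≤ (F.ends ∪ F'.ends).card := by
  have h1 : (F.ends ∩ F'.ends).card ≤ 1 := by
    refine Finset.card_le_one.2 fun z hz z' hz' => ?_
    by_contra hne
    rw [Finset.mem_inter] at hz hz'
    exact h (eq_of_mem_ends hne hz.1 hz'.1 hz.2 hz'.2)
  have h2 := Finset.card_union_add_card_inter F.ends F'.ends
  rw [card_ends, card_ends] at h2
  omega

end FamilyIndex

/-- The parity of the number of coordinates `1`. -/
def parity (z : Label N) : ZMod 2 := ∑ i, if z i then 1 else 0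

theorem parity_endpoint (F : FamilyIndex N) :
    parity (F.endpoint true) = 1 + parity (F.endpoint false) := by
  rw [parity, parity, Fintype.sum_eq_add_sum_compl F.1, Fintype.sum_eq_add_sum_compl F.1]
  simp only [FamilyIndex.endpoint_self, if_true, Bool.false_eq_true, if_false, zero_add]
  congr 1
  refine Finset.sum_congr rfl fun i hi => ?_
  have : i ≠ F.1 := by simpa using hi
  simp [FamilyIndex.endpoint, this]

/-- Edges of the cube with all their endpoints in a set of three vertices number at most two. -/
theorem card_families_le_two {S : Finset (FamilyIndex N)} {Z : Finset (Label N)}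
    (hZ : Z.card ≤ 3) (hS : ∀ F ∈ S, F.ends ⊆ Z) : S.card ≤ 2 := by
  classical
  -- The cube is bipartite by parity, so an edge is determined by its even and odd ends. With `a`
  -- even and `b` odd vertices and `a + b ≤ 3` there are at most `a * b ≤ 2` edges.
  let f : FamilyIndex N → Label N × Label N := fun F =>
    if parity (F.endpoint false) = 0 then (F.endpoint false, F.endpoint true)
    else (F.endpoint true, F.endpoint false)
  have hf : ∀ F, (f F).1 ∈ F.ends ∧ (f F).2 ∈ F.ends ∧ (f F).1 ≠ (f F).2 ∧
      parity (f F).1 = 0 ∧ parity (f F).2 ≠ 0 := by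
    intro F
    have hp := parity_endpoint F
    have hd : ∀ a : ZMod 2, a ≠ 0 → 1 + a = 0 := by decide
    by_cases h : parity (F.endpoint false) = 0
    · simp [f, h, FamilyIndex.ends, F.endpoint_ne, hp]
    · simp [f, h, FamilyIndex.ends, F.endpoint_ne.symm, hp, hd _ h]
  have h1 : S.card ≤ ((Z.filter fun z => parity z = 0) ×ˢ
      (Z.filter fun z => ¬ parity z = 0)).card := by
    refine Finset.card_le_card_of_injOn f (fun F hF => ?_) fun F _ F' _ h => ?_
    · obtain ⟨h1, h2, -, h3, h4⟩ := hf F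
      simp only [Finset.coe_product, Set.mem_prod, Finset.mem_coe, Finset.mem_filter]
      exact ⟨⟨hS F hF h1, h3⟩, hS F hF h2, h4⟩
    · obtain ⟨h1, h2, h3, -⟩ := hf F
      obtain ⟨h1', h2', -⟩ := hf F'
      rw [← h] at h1' h2'
      exact FamilyIndex.eq_of_mem_ends h3 h1 h2 h1' h2'
  rw [Finset.card_product] at h1
  have h2 := Finset.card_filter_add_card_filter_not (s := Z) fun z => parity z = 0
  refine h1.trans ?_
  generalize (Z.filter fun z => parity z = 0).card = a at *
  generalize (Z.filter fun z => ¬ parity z = 0).card = b at *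
  have ha : a ≤ 3 := by omega
  interval_cases a <;> omega

theorem height_of_mem_ends (n : FamilyIndex N → ℤ) {F : FamilyIndex N} {z : Label N}
    (hz : z ∈ F.ends) : height n z (F.1 + 1) = n F := by
  simp [height, FamilyIndex.mem_ends.1 hz]

/-! ### Size as a sum of total variations -/

/-- The variation of the heights over a label. -/
def variation (n : FamilyIndex N → ℤ) (z : Label N) : ℤ :=
  ∑ j ∈ Finset.range N, |height n z (j + 1) - height n z j|

theorem variation_nonneg (n : FamilyIndex N → ℤ) (z : Label N) : 0 ≤ variation n z :=
  Finset.sum_nonneg fun _ _ => abs_nonneg _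

theorem absSize_familySum (n : FamilyIndex N → ℤ) :
    absSize (familySum n) = ∑ z, variation n z := by
  rw [absSize, Fintype.sum_prod_type_right]
  refine Finset.sum_congr rfl fun z _ => ?_
  rw [variation, Finset.sum_range]
  exact Finset.sum_congr rfl fun k _ => by rw [familySum_apply]

theorem abs_sub_le_sum_Ico (h : ℕ → ℤ) {a b : ℕ} (hab : a ≤ b) :
    |h b - h a| ≤ ∑ j ∈ Finset.Ico a b, |h (j + 1) - h j| := by
  rw [← Finset.sum_Ico_sub h hab]
  exact Finset.abs_sum_le_sum_abs _ _

/-- The heights start at 0, pass through the two given values and return to 0; the triangle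
inequality bounds each of the three stretches. -/
theorem le_variation (n : FamilyIndex N → ℤ) (z : Label N) {m m' : ℕ} (h : m ≤ N) (h' : m' ≤ N) :
    |height n z m| + |height n z m' - height n z m| + |height n z m'| ≤ variation n z := by
  wlog hm : m ≤ m' generalizing m m'
  · have := this h' h (le_of_not_ge hm)
    rw [abs_sub_comm] at this
    linarith
  have h1 := abs_sub_le_sum_Ico (height n z) (Nat.zero_le m)
  have h2 := abs_sub_le_sum_Ico (height n z) hm
  have h3 := abs_sub_le_sum_Ico (height n z) h'
  have h4 : height n z N = 0 := by
    cases N with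
    | zero => rfl
    | succ N => simp [height]
  have h5 : height n z 0 = 0 := rfl
  rw [h4, zero_sub, abs_neg] at h3
  rw [h5, sub_zero] at h1
  rw [variation, Finset.range_eq_Ico, ← Finset.sum_Ico_consecutive _ (Nat.zero_le m) h,
    ← Finset.sum_Ico_consecutive _ hm h']
  linarith

theorem two_mul_le_variation (n : FamilyIndex N → ℤ) {F : FamilyIndex N} {z : Label N}
    (hz : z ∈ F.ends) : 2 * |n F| ≤ variation n z := by
  have hF : F.1 + 1 ≤ N := by have := F.1.isLt; omega
  have := le_variation n z hF hF
  rw [height_of_mem_ends n hz, sub_self, abs_zero] at this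
  linarith

theorem mul_card_le_absSize (n : FamilyIndex N → ℤ) {U : Finset (Label N)} {c : ℤ}
    (h : ∀ z ∈ U, c ≤ variation n z) : U.card * c ≤ absSize (familySum n) := by
  rw [absSize_familySum, ← nsmul_eq_mul]
  exact (Finset.card_nsmul_le_sum U _ c h).trans
    (Finset.sum_le_univ_sum_of_nonneg fun z => variation_nonneg n z)

theorem two_le_variation {n : FamilyIndex N → ℤ} {F : FamilyIndex N} (hF : n F ≠ 0)
    {z : Label N} (hz : z ∈ F.ends) : 2 ≤ variation n z := by
  have h1 := two_mul_le_variation n hz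
  have h2 := Int.one_le_abs hF
  linarith

theorem six_le_absSize {n : FamilyIndex N → ℤ} {F F' : FamilyIndex N} (hF : n F ≠ 0)
    (hF' : n F' ≠ 0) (h : F ≠ F') : 6 ≤ absSize (familySum n) := by
  have h1 := mul_card_le_absSize n (U := F.ends ∪ F'.ends) (c := 2) fun z hz => by
    rcases Finset.mem_union.1 hz with hz | hz
    · exact two_le_variation hF hz
    · exact two_le_variation hF' hz
  have h2 := FamilyIndex.three_le_card_union h
  have h3 : (3 : ℤ) ≤ (F.ends ∪ F'.ends).card := by exact_mod_cast h2
  linarith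

/-- Disjoint edges give four labels of variation at least 2. At a shared label the heights take the
values 1 and -1, so the variation is at least 4, and at least two other labels add 2 each. -/
theorem eight_le_absSize_of_opposite {n : FamilyIndex N → ℤ} {F F' : FamilyIndex N}
    (hF : n F = 1) (hF' : n F' = -1) : 8 ≤ absSize (familySum n) := by
  have hne : F ≠ F' := by rintro rfl; omega
  have hU : ∀ z ∈ F.ends ∪ F'.ends, 2 ≤ variation n z := fun z hz => by
    rcases Finset.mem_union.1 hz with hz | hz
    · exact two_le_variation (by omega) hz
    · exact two_le_variation (F := F') (by omega) hz
  have hc := FamilyIndex.three_le_card_union hne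
  by_cases hd : Disjoint F.ends F'.ends
  · have h1 := mul_card_le_absSize n hU
    rw [Finset.card_union_of_disjoint hd, F.card_ends, F'.card_ends] at h1
    exact h1
  · obtain ⟨z, hz, hz'⟩ := Finset.not_disjoint_iff.1 hd
    have h1 : 4 ≤ variation n z := by
      have := le_variation n z (m := F.1 + 1) (m' := F'.1 + 1) (by have := F.1.isLt; omega)
        (by have := F'.1.isLt; omega)
      rw [height_of_mem_ends n hz, height_of_mem_ends n hz', hF, hF'] at this
      norm_num at this
      exact this
    have hzU : z ∈ F.ends ∪ F'.ends := Finset.mem_union_left _ hz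
    have h2 := Finset.card_nsmul_le_sum ((F.ends ∪ F'.ends).erase z) (variation n) 2
      fun w hw => hU w (Finset.mem_of_mem_erase hw)
    have h3 : 2 ≤ ((F.ends ∪ F'.ends).erase z).card := by
      rw [Finset.card_erase_of_mem hzU]; omega
    have h4 : (2 : ℤ) ≤ ((F.ends ∪ F'.ends).erase z).card := by exact_mod_cast h3
    have h5 := Finset.add_sum_erase _ (variation n) hzU
    have h6 := Finset.sum_le_univ_sum_of_nonneg (s := F.ends ∪ F'.ends)
      fun z => variation_nonneg n z
    rw [absSize_familySum]
    rw [nsmul_eq_mul] at h2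
    linarith

/-- Each active family costs at least `2 |n F|` at both of its labels, so size at most 6 forces `|n
F| ≤ 1` and at most three labels. Three vertices of the cube span at most two edges, and opposite
signs would cost 8. -/
theorem familySum_cases {n : FamilyIndex N → ℤ} (h : absSize (familySum n) ≤ 6) :
    familySum n = 0 ∨
    (∃ F : FamilyIndex N, familySum n = F.vec ∨ familySum n = -F.vec) ∨
    (6 ≤ absSize (familySum n) ∧ ∃ F F' : FamilyIndex N, F ≠ F' ∧
      (familySum n = F.vec + F'.vec ∨ familySum n = -(F.vec + F'.vec))) := by
  classical
  let S : Finset (FamilyIndex N) := Finset.univ.filter fun F => n F ≠ 0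
  have hS : ∀ F, F ∈ S ↔ n F ≠ 0 := fun F => by simp [S]
  have hval : ∀ F ∈ S, n F = 1 ∨ n F = -1 := fun F hF => by
    have h1 := mul_card_le_absSize n (U := F.ends) (c := 2 * |n F|)
      fun z hz => two_mul_le_variation n hz
    rw [F.card_ends] at h1
    have h2 : |n F| ≤ 1 := by push_cast at h1; omega
    have h3 := (hS F).1 hF
    rw [abs_le] at h2
    omega
  have hcard : S.card ≤ 2 := by
    refine card_families_le_two (Z := S.biUnion FamilyIndex.ends) ?_
      fun F hF => Finset.subset_biUnion_of_mem FamilyIndex.ends hF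
    have h1 := mul_card_le_absSize n (U := S.biUnion FamilyIndex.ends) (c := 2) fun z hz => by
      obtain ⟨F, hF, hz⟩ := Finset.mem_biUnion.1 hz
      exact two_le_variation ((hS F).1 hF) hz
    have h2 : ((S.biUnion FamilyIndex.ends).card : ℤ) ≤ 3 := by linarith
    exact_mod_cast h2
  have hsum : familySum n = ∑ F ∈ S, n F • FamilyIndex.vec F := by
    refine (Finset.sum_subset (Finset.subset_univ S) fun F _ hF => ?_).symm
    rw [hS, not_not] at hF
    rw [hF, zero_smul]
  obtain h0 | h0 | h0 : S.card = 0 ∨ S.card = 1 ∨ S.card = 2 := by omega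
  · left
    rw [hsum, Finset.card_eq_zero.1 h0, Finset.sum_empty]
  · obtain ⟨F, hF⟩ := Finset.card_eq_one.1 h0
    refine .inr (.inl ⟨F, ?_⟩)
    rw [hsum, hF, Finset.sum_singleton]
    rcases hval F (by simp [hF]) with h1 | h1 <;> simp [h1]
  · obtain ⟨F, F', hne, hF⟩ := Finset.card_eq_two.1 h0
    have h1 := hval F (by simp [hF])
    have h2 := hval F' (by simp [hF])
    refine .inr (.inr ⟨six_le_absSize ((hS F).1 (by simp [hF])) ((hS F').1 (by simp [hF])) hne,
      F, F', hne, ?_⟩)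
    rw [hsum, hF, Finset.sum_pair hne]
    rcases h1 with h1 | h1 <;> rcases h2 with h2 | h2
    · simp [h1, h2]
    · exact absurd (eight_le_absSize_of_opposite h1 h2) (by omega)
    · exact absurd (eight_le_absSize_of_opposite h2 h1) (by omega)
    · right; simp [h1, h2]; abel

/-! ### Unit vectors plus short combinations of families -/

theorem absSize_single (a : Member N) (c : ℤ) : absSize (Pi.single a c) = |c| := by
  rw [absSize, Finset.sum_eq_single a] <;> simp +contextual

theorem absSize_neg (l : Member N → ℤ) : absSize (-l) = absSize l := by simp [absSize]

theorem absSize_add_le (l m : Member N → ℤ) : absSize (l + m) ≤ absSize l + absSize m := by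
  rw [absSize, absSize, absSize, ← Finset.sum_add_distrib]
  exact Finset.sum_le_sum fun a _ => abs_add_le _ _

theorem sum_mul_le_absSize {σ : Member N → ℤ} (hσ : ∀ a, |σ a| ≤ 1) (l : Member N → ℤ) :
    ∑ a, σ a * l a ≤ absSize l := by
  refine Finset.sum_le_sum fun a _ => (le_abs_self _).trans ?_
  rw [abs_mul]
  exact mul_le_of_le_one_left (abs_nonneg _) (hσ a)

theorem FamilyIndex.parent_ne (F : FamilyIndex N) : F.parent false ≠ F.parent true := fun h =>
  F.endpoint_ne (congrArg Prod.snd h)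

theorem FamilyIndex.parent_ne_child (F F' : FamilyIndex N) (h : (F.1 : ℕ) ≤ F'.1) (b b' : Bool) :
    F.parent b ≠ F'.child b' := fun e => by
  have := congrArg (fun a : Member N => (a.1 : ℕ)) e
  simp only [FamilyIndex.parent, FamilyIndex.child, FamilyIndex.parentGen,
    FamilyIndex.childGen] at this
  omega

/-- Pairing with the signs `-1` on the children and `+1` elsewhere gives exactly 5: nothing cancels
unless `u` is a child. -/
theorem five_le_absSize_add_vec {F : FamilyIndex N} {u : Member N} (h : ∀ b, u ≠ F.child b) :
    5 ≤ absSize (Pi.single u 1 + F.vec) := by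
  classical
  have h1 := sum_mul_le_absSize (σ := fun a => if ∃ b, a = F.child b then -1 else 1)
    (fun a => by split_ifs <;> simp) (Pi.single u 1 + F.vec)
  have h2 : ∀ b b', F.parent b ≠ F.child b' := F.parent_ne_child F le_rfl
  simpa [FamilyIndex.vec, mul_add, mul_sub, Finset.sum_add_distrib, Finset.sum_sub_distrib,
    Pi.single_apply, h, h2] using h1

theorem five_le_absSize_sub_vec {F : FamilyIndex N} {u : Member N} (h : ∀ b, u ≠ F.parent b) :
    5 ≤ absSize (Pi.single u 1 - F.vec) := by
  classical
  have h1 := sum_mul_le_absSize (σ := fun a => if ∃ b, a = F.parent b then -1 else 1)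
    (fun a => by split_ifs <;> simp) (Pi.single u 1 - F.vec)
  have h2 : ∀ b b', F.child b ≠ F.parent b' := fun b b' =>
    (F.parent_ne_child F le_rfl b' b).symm
  simpa [FamilyIndex.vec, mul_add, mul_sub, Finset.sum_add_distrib, Finset.sum_sub_distrib,
    Pi.single_apply, h, h2] using h1

/-- The vectors `e_u + ∑ n_F λ^F` of size at most five. -/
inductive UnitForm (l : Member N → ℤ) : Prop
  | single (u : Member N) (h : l = Pi.single u 1)
  | parents (F : FamilyIndex N) (b : Bool) (h : l = Pi.single (F.parent false) 1 +
      Pi.single (F.parent true) 1 - Pi.single (F.child b) 1)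
  | children (F : FamilyIndex N) (b : Bool) (h : l = Pi.single (F.child false) 1 +
      Pi.single (F.child true) 1 - Pi.single (F.parent b) 1)
  | family (u : Member N) (F : FamilyIndex N) (hs : 5 ≤ absSize l)
      (h : l = F.vec + Pi.single u 1 ∨ l = -F.vec + Pi.single u 1)
  | couple (u : Member N) (F F' : FamilyIndex N) (hF : F ≠ F') (hs : 5 ≤ absSize l)
      (hs' : absSize (l - Pi.single u 1) ≤ 6)
      (h : l - Pi.single u 1 = F.vec + F'.vec ∨ l - Pi.single u 1 = -(F.vec + F'.vec))

/-- Removing `e_u` raises the size to at most 6, where `familySum_cases` applies. For one family,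
`e_u` either cancels against a negative coefficient, leaving three members, or the size is 5; for
two families the size 6 of the couple gives at least 5. -/
theorem unitForm_of_eq {l : Member N → ℤ} {u : Member N} {n : FamilyIndex N → ℤ}
    (h : l = Pi.single u 1 + familySum n) (hs : absSize l ≤ 5) : UnitForm l := by
  have e : familySum n = l - Pi.single u 1 := by rw [h]; abel
  have hn : absSize (familySum n) ≤ 6 := by
    have := absSize_add_le l (-Pi.single u 1)
    rw [absSize_neg, absSize_single, ← sub_eq_add_neg, ← e] at this
    simp only [abs_one] at this
    linarith
  rcases familySum_cases hn with h0 | ⟨F, h0⟩ | ⟨h6, F, F', hF, h0⟩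
  · exact .single u (by rw [h, h0, add_zero])
  · rcases h0 with h0 | h0
    · by_cases hu : ∀ b, u ≠ F.child b
      · refine .family u F ?_ (.inl (by rw [h, h0, add_comm]))
        rw [h, h0]
        exact five_le_absSize_add_vec hu
      · push Not at hu
        obtain ⟨b, rfl⟩ := hu
        refine .parents F (!b) ?_
        rw [h, h0, FamilyIndex.vec]
        cases b <;> simp only [Bool.not_false, Bool.not_true] <;> abel
    · by_cases hu : ∀ b, u ≠ F.parent b
      · refine .family u F ?_ (.inr (by rw [h, h0, add_comm]))
        rw [h, h0, ← sub_eq_add_neg]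
        exact five_le_absSize_sub_vec hu
      · push Not at hu
        obtain ⟨b, rfl⟩ := hu
        refine .children F (!b) ?_
        rw [h, h0, FamilyIndex.vec]
        cases b <;> simp only [Bool.not_false, Bool.not_true] <;> abel
  · refine .couple u F F' hF ?_ (by rw [← e]; exact hn) (by rw [← e]; exact h0)
    have := absSize_add_le l (-Pi.single u 1)
    rw [absSize_neg, absSize_single, ← sub_eq_add_neg, ← e] at this
    simp only [abs_one] at this
    linarith

/-! ## Generic parameters -/

/-- The vectors to which the non-degeneracy condition applies and whose defect does not vanish
identically. -/
def excludedVectors (N : ℕ) : Set (Member N → ℤ) :=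
  {l | ∑ a, l a = 1 ∧ absSize l ≤ 5 ∧ ¬ ∀ x, defect x l = 0}

/-- Bounded size bounds every coefficient; finiteness is what keeps the union of zero sets closed.
-/
theorem finite_excludedVectors : (excludedVectors N).Finite := by
  refine (Set.finite_Icc (fun _ : Member N => (-5 : ℤ)) fun _ => 5).subset fun l hl => ?_
  have h : ∀ a, |l a| ≤ 5 := fun a =>
    (Finset.single_le_sum (f := fun a => |l a|) (fun a _ => abs_nonneg _)
      (Finset.mem_univ a)).trans hl.2.1
  exact ⟨fun a => (abs_le.1 (h a)).1, fun a => (abs_le.1 (h a)).2⟩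

/-- The parameters at which the defect of an excluded vector vanishes. -/
def degenerateSet (N : ℕ) : Set (Params N) := ⋃ l ∈ excludedVectors N, {x | defect x l = 0}

theorem isClosed_degenerateSet : IsClosed (degenerateSet N) :=
  finite_excludedVectors.isClosed_biUnion fun l _ =>
    isClosed_singleton.preimage (lineAnalytic_defect l).continuous

theorem volume_degenerateSet : MeasureTheory.volume (degenerateSet N) = 0 :=
  (MeasureTheory.measure_biUnion_null_iff finite_excludedVectors.countable).2 fun l hl =>
    (lineAnalytic_defect l).zeroOrNull.resolve_left hl.2.2

section Generic

variable {x : Params N}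

theorem exists_familySum_of_notMem (hx : x ∉ degenerateSet N) {l : Member N → ℤ}
    (h1 : ∑ a, l a = 1) (h5 : absSize l ≤ 5) (h0 : defect x l = 0) :
    ∃ u n, l = Pi.single u 1 + familySum n := by
  refine exists_familySum_of_defect ?_ h1
  by_contra h
  exact hx (Set.mem_biUnion (show l ∈ excludedVectors N from ⟨h1, h5, h⟩) h0)

/-- If `a` and `b` share a position `p`, then `2 e_a - e_b` has mass one and defect `2|p|² - |p|² -
|p|² = 0`, but no vector of size 3 in `UnitForm` has a coefficient 2. -/
theorem position_injective (hx : x ∉ degenerateSet N) : Function.Injective (position x) := by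
  intro a b hab
  by_contra hne
  let l : Member N → ℤ := Pi.single a 2 - Pi.single b 1
  have hs : absSize l ≤ 3 := by
    have := absSize_add_le (Pi.single a 2) (-Pi.single b 1)
    rw [absSize_neg, absSize_single, absSize_single, ← sub_eq_add_neg] at this
    simpa using this
  have hla : l a = 2 := by simp [l, hne]
  have hlb : l b = -1 := by simp [l, Ne.symm hne]
  obtain ⟨u, n, h⟩ := exists_familySum_of_notMem hx (l := l) (by simp [l]) (by linarith) (by
    simp only [defect, l, map_sub, weight_single, sqPosition, hab]
    push_cast
    simp only [map_ofNat, map_mul, map_one]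
    ring)
  rcases unitForm_of_eq h (by linarith) with ⟨u, h⟩ | ⟨F, c, h⟩ | ⟨F, c, h⟩ | ⟨_, _, h, _⟩ |
    ⟨_, _, _, _, h, _⟩
  · rw [h, Pi.single_apply] at hlb
    split_ifs at hlb
  · have := F.parent_ne
    rw [h] at hla
    simp only [Pi.add_apply, Pi.sub_apply, Pi.single_apply] at hla
    split_ifs at hla <;> simp_all
  · have := F.child_ne
    rw [h] at hla
    simp only [Pi.add_apply, Pi.sub_apply, Pi.single_apply] at hla
    split_ifs at hla <;> simp_all
  · linarith
  · linarith

/-- Adding `e_a` where `l` is negative lowers the size to 5 and gives mass one and zero defect. The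
result is `e_u` plus families, and comparing momenta identifies `u` with `a`. -/
theorem eq_familySum_of_resonant (hx : x ∉ degenerateSet N) {l : Member N → ℤ}
    (h0 : ∑ a, l a = 0) (h6 : absSize l ≤ 6) (hm : weight (position x) l = 0)
    (he : weight (sqPosition x) l = 0) : ∃ n, l = familySum n := by
  by_cases hl : ∀ a, 0 ≤ l a
  · refine ⟨0, ?_⟩
    funext a
    rw [(Finset.sum_eq_zero_iff_of_nonneg fun a _ => hl a).1 h0 a (Finset.mem_univ a)]
    simp [familySum]
  push Not at hl
  obtain ⟨a, ha⟩ := hl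
  have hs : absSize (l + Pi.single a 1) = absSize l - 1 := by
    have h1 : ∀ b, |l b + (Pi.single a 1 : Member N → ℤ) b| = |l b| - (Pi.single a 1 : Member N → ℤ) b := by
      intro b
      by_cases hb : b = a
      · subst hb
        rw [Pi.single_eq_same, abs_of_neg ha, abs_of_nonpos (by omega)]
        ring
      · simp [hb]
    simp only [absSize, Pi.add_apply, h1, Finset.sum_sub_distrib]
    simp
  obtain ⟨u, n, h⟩ := exists_familySum_of_notMem hx (l := l + Pi.single a 1)
    (by simp [Finset.sum_add_distrib, h0]) (by linarith) (by
      simp [defect, map_add, hm, he, sqPosition])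
  have h2 := congrArg (weight (position x)) h
  rw [map_add, map_add, hm, weight_position_familySum, weight_single, weight_single] at h2
  have h3 : a = u := position_injective hx (by simpa using h2)
  subst h3
  exact ⟨n, by rw [add_comm] at h; exact add_left_cancel h⟩

/-! ## Transfer to the plane -/

/-- The vector indexed by points of the plane of a vector of the abstract model. -/
def toPlane (x : Params N) : (Member N → ℤ) →+ (ℂ →₀ ℤ) where
  toFun l := Finsupp.mapDomain (position x) (Finsupp.equivFunOnFinite.symm l)
  map_zero' := by
    rw [show Finsupp.equivFunOnFinite.symm (0 : Member N → ℤ) = 0 from by ext; simp]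
    exact Finsupp.mapDomain_zero
  map_add' l m := by
    rw [show Finsupp.equivFunOnFinite.symm (l + m) =
      Finsupp.equivFunOnFinite.symm l + Finsupp.equivFunOnFinite.symm m from by ext; simp]
    exact Finsupp.mapDomain_add

theorem toPlane_single (x : Params N) (a : Member N) (c : ℤ) :
    toPlane x (Pi.single a c) = Finsupp.single (position x a) c := by
  change Finsupp.mapDomain _ _ = _
  rw [Finsupp.equivFunOnFinite_symm_single, Finsupp.mapDomain_single]

theorem toPlane_apply (hx : Function.Injective (position x)) (l : Member N → ℤ) (a : Member N) :
    toPlane x l (position x a) = l a :=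
  Finsupp.mapDomain_apply hx _ _

theorem allPoints_generations (x : Params N) :
    allPoints (generations x) = Set.range (position x) := by
  ext v
  simp [allPoints, generations]

theorem exists_toPlane_eq (hx : Function.Injective (position x)) {l : ℂ →₀ ℤ}
    (hl : (l.support : Set ℂ) ⊆ allPoints (generations x)) : ∃ m, l = toPlane x m := by
  rw [allPoints_generations] at hl
  refine ⟨fun a => l (position x a), ?_⟩
  ext v
  by_cases hv : v ∈ Set.range (position x)
  · obtain ⟨a, rfl⟩ := hv
    rw [toPlane_apply hx]
  · refine Eq.trans ?_ (Finsupp.mapDomain_of_notMem_range _ _ hv).symm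
    by_contra h
    exact hv (hl (by simpa using h))

theorem sum_toPlane {M : Type*} [AddCommMonoid M] (hx : Function.Injective (position x))
    (l : Member N → ℤ) (g : ℂ → ℤ → M) (hg : ∀ v, g v 0 = 0) :
    (toPlane x l).sum g = ∑ a, g (position x a) (l a) := by
  refine (Finsupp.sum_mapDomain_index_inj hx).trans ?_
  rw [Finsupp.sum_fintype _ _ fun a => hg _]
  rfl

theorem mass_toPlane (hx : Function.Injective (position x)) (l : Member N → ℤ) :
    mass (toPlane x l) = ∑ a, l a := sum_toPlane hx l _ fun _ => rfl

theorem size_toPlane (hx : Function.Injective (position x)) (l : Member N → ℤ) :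
    size (toPlane x l) = absSize l := sum_toPlane hx l _ fun _ => abs_zero

theorem momentum_toPlane (hx : Function.Injective (position x)) (l : Member N → ℤ) :
    momentum (toPlane x l) = weight (position x) l := sum_toPlane hx l _ fun _ => by simp

theorem energy_toPlane (hx : Function.Injective (position x)) (l : Member N → ℤ) :
    (energy (toPlane x l) : ℂ) = weight (sqPosition x) l := by
  rw [energy, sum_toPlane hx l _ fun _ => by simp, weight_apply, Complex.ofReal_sum]
  refine Finset.sum_congr rfl fun a _ => ?_
  rw [sqPosition, Complex.mul_conj']
  push_cast
  rfl

theorem defect_eq (hx : Function.Injective (position x)) (l : Member N → ℤ) :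
    defect x l = ((energy (toPlane x l) - ‖momentum (toPlane x l)‖ ^ 2 : ℝ) : ℂ) := by
  rw [Complex.ofReal_sub, energy_toPlane hx, momentum_toPlane hx, defect, Complex.mul_conj']
  push_cast
  rfl

/-! ### Families of the plane and the generation set property -/

/-- The family of the plane given by an abstract family. -/
def quad (x : Params N) (F : FamilyIndex N) : Quad :=
  ⟨position x (F.parent false), position x (F.parent true), position x (F.child false),
    position x (F.child true)⟩

theorem toPlane_vec (x : Params N) (F : FamilyIndex N) :
    toPlane x F.vec = (quad x F).vec := by
  simp only [FamilyIndex.vec, map_add, map_sub, toPlane_single, Quad.vec, quad]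

theorem isFamily_quad (hx : Function.Injective (position x)) (F : FamilyIndex N) :
    IsFamily (generations x) F.1 (quad x F) := by
  have hc := F.child_ne
  have hp := F.parent_ne
  have hpc : ∀ b b', F.parent b ≠ F.child b' := F.parent_ne_child F le_rfl
  have hF : (F.1 : ℕ) + 1 < N := by have := F.1.isLt; omega
  have h1 := weight_position_vec x F
  have h2 := weight_sqPosition_vec x F
  simp only [FamilyIndex.vec, map_add, map_sub, weight_single, sqPosition, Complex.mul_conj',
    Int.cast_one, one_mul] at h1 h2
  refine ⟨hF, ⟨_, rfl⟩, ⟨_, rfl⟩, ⟨_, rfl⟩, ⟨_, rfl⟩, ?_, ?_, ?_⟩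
  · simp only [quad]
    linear_combination h1
  · simp only [quad]
    have h3 : ((‖position x (F.parent false)‖ ^ 2 + ‖position x (F.parent true)‖ ^ 2 : ℝ) : ℂ) =
        ((‖position x (F.child false)‖ ^ 2 + ‖position x (F.child true)‖ ^ 2 : ℝ) : ℂ) := by
      push_cast
      linear_combination h2
    exact_mod_cast h3
  · simp [quad, hx.eq_iff, hc, hp, hpc]

theorem trivialPerm_quad_iff (hx : Function.Injective (position x)) {F F' : FamilyIndex N} :
    (quad x F).TrivialPerm (quad x F') → F = F' := by
  intro h
  have h1 : F'.endpoint false ∈ F.ends ∧ F'.endpoint true ∈ F.ends := by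
    have key : ∀ {b c : Bool}, position x (F'.parent b) = position x (F.parent c) →
        F'.endpoint b ∈ F.ends := fun {b c} e => by
      have := congrArg Prod.snd (hx e)
      simp only [FamilyIndex.parent] at this
      rw [FamilyIndex.mem_ends, this, FamilyIndex.familyOf_endpoint]
    simp only [Quad.TrivialPerm, quad, Quad.mk.injEq] at h
    rcases h with h | h | h | h <;> exact ⟨key h.1, key h.2.1⟩
  refine FamilyIndex.eq_of_mem_ends F'.endpoint_ne h1.1 h1.2 ?_ ?_ <;>
    simp [FamilyIndex.mem_ends]

theorem Quad.TrivialPerm.points_eq {F F' : Quad} (h : F.TrivialPerm F') :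
    F'.points = F.points := by
  rcases h with h | h | h | h <;> subst h <;> ext v <;> simp only [Quad.points,
    Set.mem_insert_iff, Set.mem_singleton_iff] <;> tauto

theorem position_mem_points (hx : Function.Injective (position x)) {F : FamilyIndex N}
    {a : Member N} (h : position x a ∈ (quad x F).points) :
    ∃ b, a = F.parent b ∨ a = F.child b := by
  simp only [Quad.points, quad, Set.mem_insert_iff, Set.mem_singleton_iff, hx.eq_iff] at h
  rcases h with h | h | h | h
  exacts [⟨_, .inl h⟩, ⟨_, .inl h⟩, ⟨_, .inr h⟩, ⟨_, .inr h⟩]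

/-- Every family of the plane comes from an abstract family. -/
theorem IsFamily.exists_quad (hx : x ∉ degenerateSet N) {i : ℕ} {Q : Quad}
    (h : IsFamily (generations x) i Q) :
    ∃ F : FamilyIndex N, (F.1 : ℕ) = i ∧ (quad x F).TrivialPerm Q := by
  have hinj := position_injective hx
  obtain ⟨hi, ⟨z₁, h1⟩, ⟨z₂, h2⟩, ⟨w₁, h3⟩, ⟨w₂, h4⟩, hsum, hsq, hnd⟩ := h
  obtain ⟨p₁, p₂, c₁, c₂⟩ := Q
  simp only at h1 h2 h3 h4 hsum hsq hnd
  subst h1 h2 h3 h4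
  set g : Fin N := ⟨i, Nat.lt_of_succ_lt hi⟩
  set g' : Fin N := ⟨i + 1, hi⟩
  have hgg : g ≠ g' := by simp [g, g']
  have hz : z₁ ≠ z₂ := by rintro rfl; simp at hnd
  have hw : w₁ ≠ w₂ := by rintro rfl; simp at hnd
  -- The vector of the given rectangle is resonant of size at most 4; couples have size at least 6,
  -- so it is plus or minus the vector of one abstract family.
  let l : Member N → ℤ := Pi.single (g, z₁) 1 + Pi.single (g, z₂) 1 - Pi.single (g', w₁) 1 -
    Pi.single (g', w₂) 1
  have hl1 : l (g, z₁) = 1 := by simp [l, hgg, hz]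
  have hl2 : l (g, z₂) = 1 := by simp [l, hgg, hz.symm]
  have hl3 : l (g', w₁) = -1 := by simp [l, hgg.symm, hw]
  have hl4 : l (g', w₂) = -1 := by simp [l, hgg.symm, hw.symm]
  have hs : absSize l ≤ 4 := by
    have e1 := absSize_add_le (Pi.single (g, z₁) 1) (Pi.single (g, z₂) 1)
    have e2 := absSize_add_le (Pi.single (g, z₁) 1 + Pi.single (g, z₂) 1) (-Pi.single (g', w₁) 1)
    have e3 := absSize_add_le (Pi.single (g, z₁) 1 + Pi.single (g, z₂) 1 - Pi.single (g', w₁) 1)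
      (-Pi.single (g', w₂) 1)
    simp only [absSize_neg, absSize_single, ← sub_eq_add_neg, abs_one] at e1 e2 e3
    linarith
  obtain ⟨n, hn⟩ := eq_familySum_of_resonant hx (l := l)
    (by simp [l, Finset.sum_add_distrib]) (by linarith)
    (by simp only [l, map_add, map_sub, weight_single]
        push_cast
        linear_combination hsum)
    (by simp only [l, map_add, map_sub, weight_single, sqPosition, Complex.mul_conj']
        have := congrArg (fun r : ℝ => (r : ℂ)) hsq
        push_cast at this ⊢
        linear_combination this)
  rcases familySum_cases (n := n) (by rw [← hn]; linarith) with h0 | ⟨F, h0⟩ | ⟨h6, -⟩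
  · rw [hn, h0] at hl1
    simp at hl1
  · have hvec1 : ∀ {a : Member N}, F.vec a = 1 → (a.1 : ℕ) = F.1 ∧ familyOf F.1 a.2 = F := by
      intro a ha
      rw [FamilyIndex.vec_apply] at ha
      split_ifs at ha <;> first | assumption | omega
    have hvec2 : ∀ {a : Member N}, F.vec a = -1 → (a.1 : ℕ) = F.1 + 1 ∧
        familyOf F.1 a.2 = F := by
      intro a ha
      rw [FamilyIndex.vec_apply] at ha
      split_ifs at ha <;> first | assumption | omega
    rw [hn] at hl1 hl2 hl3 hl4
    rcases h0 with h0 | h0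
    · rw [h0] at hl1 hl2 hl3 hl4
      obtain ⟨hg, k1⟩ := hvec1 hl1
      obtain ⟨-, k2⟩ := hvec1 hl2
      obtain ⟨-, k3⟩ := hvec2 hl3
      obtain ⟨-, k4⟩ := hvec2 hl4
      refine ⟨F, hg.symm, ?_⟩
      have e1 : F.parentGen = g := Fin.ext hg.symm
      have e2 : F.childGen = g' := Fin.ext (congrArg (· + 1) hg.symm)
      simp only [FamilyIndex.familyOf_eq_iff] at k1 k2 k3 k4
      simp only [Quad.TrivialPerm, quad, FamilyIndex.parent, FamilyIndex.child, e1, e2]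
      rcases k1 with k1 | k1 <;> rcases k2 with k2 | k2 <;>
        first | exact absurd (k1.trans k2.symm) hz | skip
      all_goals
        rcases k3 with k3 | k3 <;> rcases k4 with k4 | k4 <;>
          first | exact absurd (k3.trans k4.symm) hw | simp [k1, k2, k3, k4]
    -- The opposite sign would make the parents of the rectangle one generation younger than its
    -- children.
    · rw [h0, Pi.neg_apply] at hl1 hl3
      obtain ⟨e1, -⟩ := hvec2 (a := (g, z₁)) (by omega)
      obtain ⟨e2, -⟩ := hvec1 (a := (g', w₁)) (by omega)
      simp only [g, g'] at e1 e2
      omega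
  · rw [← hn] at h6
    linarith

theorem mem_points_parent (x : Params N) (F : FamilyIndex N) (b : Bool) :
    position x (F.parent b) ∈ (quad x F).points := by
  cases b <;> simp [Quad.points, quad]

theorem mem_points_child (x : Params N) (F : FamilyIndex N) (b : Bool) :
    position x (F.child b) ∈ (quad x F).points := by
  cases b <;> simp [Quad.points, quad]

theorem AreSpouses.exists_parent (hx : x ∉ degenerateSet N) {v w : ℂ}
    (h : AreSpouses (generations x) v w) :
    ∃ (F : FamilyIndex N) (b : Bool), v = position x (F.parent b) ∧
      w = position x (F.parent !b) := by
  obtain ⟨i, Q, hQ, rfl, rfl⟩ := h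
  obtain ⟨F, -, hF⟩ := hQ.exists_quad hx
  rcases hF with h | h | h | h <;> subst h
  exacts [⟨F, false, rfl, rfl⟩, ⟨F, true, rfl, rfl⟩, ⟨F, false, rfl, rfl⟩, ⟨F, true, rfl, rfl⟩]

theorem AreSiblings.exists_child (hx : x ∉ degenerateSet N) {v w : ℂ}
    (h : AreSiblings (generations x) v w) :
    ∃ (F : FamilyIndex N) (b : Bool), v = position x (F.child b) ∧
      w = position x (F.child !b) := by
  obtain ⟨i, Q, hQ, rfl, rfl⟩ := h
  obtain ⟨F, -, hF⟩ := hQ.exists_quad hx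
  rcases hF with h | h | h | h <;> subst h
  exacts [⟨F, false, rfl, rfl⟩, ⟨F, false, rfl, rfl⟩, ⟨F, true, rfl, rfl⟩, ⟨F, true, rfl, rfl⟩]

theorem isGenerationSet_generations (hx : x ∉ degenerateSet N) :
    IsGenerationSet (generations x) := by
  have hinj := position_injective hx
  refine ⟨?_, ?_, ?_⟩
  · rintro ⟨i, hi⟩ hi1 _ ⟨z, rfl⟩
    let F : FamilyIndex N := familyOf ⟨i, Nat.lt_sub_of_add_lt hi1⟩ z
    have hz : ∃ b, ((⟨i, hi⟩, z) : Member N) = F.parent b := by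
      rcases (FamilyIndex.familyOf_eq_iff F z).1 rfl with h | h
      · exact ⟨false, Prod.ext rfl h⟩
      · exact ⟨true, Prod.ext rfl h⟩
    refine ⟨quad x F, isFamily_quad hinj F, ?_, fun Q hQ hv => ?_⟩
    · obtain ⟨b, hb⟩ := hz
      change position x (_, z) ∈ _
      rw [hb]
      exact mem_points_parent x F b
    · obtain ⟨F', hF', hQF⟩ := hQ.exists_quad hx
      rw [hQF.points_eq] at hv
      obtain ⟨b, h | h⟩ := position_mem_points hinj hv
      · obtain ⟨h1, h2⟩ := Prod.ext_iff.1 h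
        simp only [FamilyIndex.parent] at h2
        have : F = F' := by
          have e := FamilyIndex.familyOf_endpoint F' b
          rw [← h2] at e
          rw [← e]
          exact congrArg (fun k => familyOf k z) (Fin.ext hF'.symm)
        rw [this]
        exact hQF
      · have h1 := congrArg (fun a : Member N => (a.1 : ℕ)) h
        simp only [FamilyIndex.child, FamilyIndex.childGen] at h1
        simp only at hF'
        omega
  · rintro ⟨i, hi⟩ hi1 _ ⟨z, rfl⟩
    simp only at hi1
    obtain ⟨i, rfl⟩ : ∃ j, i = j + 1 := ⟨i - 1, by omega⟩
    let F : FamilyIndex N := familyOf ⟨i, Nat.lt_sub_of_add_lt hi⟩ z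
    have hz : ∃ b, ((⟨i + 1, hi⟩, z) : Member N) = F.child b := by
      rcases (FamilyIndex.familyOf_eq_iff F z).1 rfl with h | h
      · exact ⟨false, Prod.ext rfl h⟩
      · exact ⟨true, Prod.ext rfl h⟩
    refine ⟨quad x F, isFamily_quad hinj F, ?_, fun Q hQ hv => ?_⟩
    · obtain ⟨b, hb⟩ := hz
      change position x (_, z) ∈ _
      rw [hb]
      exact mem_points_child x F b
    · obtain ⟨F', hF', hQF⟩ := hQ.exists_quad hx
      rw [hQF.points_eq] at hv
      simp only [Nat.add_sub_cancel] at hF'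
      obtain ⟨b, h | h⟩ := position_mem_points hinj hv
      · have h1 := congrArg (fun a : Member N => (a.1 : ℕ)) h
        simp only [FamilyIndex.parent, FamilyIndex.parentGen] at h1
        omega
      · obtain ⟨h1, h2⟩ := Prod.ext_iff.1 h
        simp only [FamilyIndex.child] at h2
        have : F = F' := by
          have e := FamilyIndex.familyOf_endpoint F' b
          rw [← h2] at e
          rw [← e]
          exact congrArg (fun k => familyOf k z) (Fin.ext hF'.symm)
        rw [this]
        exact hQF
  -- If the spouse were the sibling, both pairs would have the same two labels and hence belong to
  -- the same abstract family, whose parents and children are in different generations.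
  · rintro i - - v - w w' hw hw' rfl
    obtain ⟨F, b, rfl, rfl⟩ := hw.exists_parent hx
    obtain ⟨F', b', h1, h2⟩ := hw'.exists_child hx
    have h1 := hinj h1
    have h2 := hinj h2
    have e : ∀ {c c'}, F.parent c = F'.child c' → F.endpoint c ∈ F.ends ∧
        F.endpoint c ∈ F'.ends := fun {c c'} h => by
      refine ⟨by simp [FamilyIndex.mem_ends], ?_⟩
      have := congrArg Prod.snd h
      simp only [FamilyIndex.parent, FamilyIndex.child] at this
      simp [FamilyIndex.mem_ends, this]
    have hne : F.endpoint b ≠ F.endpoint !b := by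
      cases b
      exacts [F.endpoint_ne, F.endpoint_ne.symm]
    obtain rfl := FamilyIndex.eq_of_mem_ends hne (e h1).1 (e h2).1 (e h1).2 (e h2).2
    exact F.parent_ne_child F le_rfl _ _ h1

/-! ### Non-degeneracy and resonant vectors in the plane -/

theorem size_support_pos_single_add_single_sub_single {p q r : ℂ} (hpq : p ≠ q) (hpr : p ≠ r) (hqr : q ≠ r) :
    size (Finsupp.single p 1 + Finsupp.single q 1 - Finsupp.single r 1) = 3 ∧
    (Finsupp.single p 1 + Finsupp.single q 1 - Finsupp.single r 1 : ℂ →₀ ℤ).support = {p, q, r} ∧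
    {v | 0 < (Finsupp.single p 1 + Finsupp.single q 1 - Finsupp.single r 1 : ℂ →₀ ℤ) v} =
      {p, q} := by
  set l : ℂ →₀ ℤ := Finsupp.single p 1 + Finsupp.single q 1 - Finsupp.single r 1 with hl
  have hp : l p = 1 := by simp [hl, hpq.symm, hpr.symm]
  have hq : l q = 1 := by simp [hl, hpq, hqr.symm]
  have hr : l r = -1 := by simp [hl, hpr, hqr]
  have h0 : ∀ v, v ≠ p → v ≠ q → v ≠ r → l v = 0 := fun v h1 h2 h3 => by
    simp [hl, h1.symm, h2.symm, h3.symm]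
  have hsupp : l.support = {p, q, r} := by
    ext v
    simp only [Finsupp.mem_support_iff, Finset.mem_insert, Finset.mem_singleton]
    constructor
    · intro h
      by_contra! h'
      exact h (h0 v h'.1 h'.2.1 h'.2.2)
    · rintro (rfl | rfl | rfl) <;> simp [hp, hq, hr]
  refine ⟨?_, hsupp, ?_⟩
  · rw [size, Finsupp.sum, hsupp, Finset.sum_insert (by simp [hpq, hpr]), Finset.sum_pair hqr,
      hp, hq, hr]
    norm_num
  · ext v
    simp only [Set.mem_ofPred_eq, Set.mem_insert_iff, Set.mem_singleton_iff]
    constructor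
    · intro h
      by_contra! h'
      by_cases hv : v = r
      · rw [hv, hr] at h; omega
      · rw [h0 v h'.1 h'.2 hv] at h; omega
    · rintro (rfl | rfl) <;> simp [hp, hq]

theorem isResonant_toPlane_of_eq (hinj : Function.Injective (position x)) {m : Member N → ℤ}
    {n : FamilyIndex N → ℤ} (h : m = familySum n) (h0 : ∑ a, m a = 0) (h6 : absSize m ≤ 6) :
    IsResonant (generations x) (toPlane x m) := by
  refine ⟨?_, by rw [mass_toPlane hinj, h0], by rwa [size_toPlane hinj],
    by rw [momentum_toPlane hinj, h, weight_position_familySum], ?_⟩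
  · rw [allPoints_generations]
    intro v hv
    by_contra hr
    exact (Finsupp.mem_support_iff.1 hv) (Finsupp.mapDomain_of_notMem_range _ _ hr)
  · have := energy_toPlane hinj m
    rw [h, weight_sqPosition_familySum] at this
    rw [h]
    exact_mod_cast this

theorem isCF_of_eq (hinj : Function.Injective (position x)) {l : ℂ →₀ ℤ}
    (hl : IsResonant (generations x) l) {F F' : FamilyIndex N} (hF : F ≠ F')
    (h : l = toPlane x (F.vec + F'.vec) ∨ l = toPlane x (-(F.vec + F'.vec))) :
    IsCF (generations x) l := by
  refine ⟨hl, F.1, F'.1, quad x F, quad x F', isFamily_quad hinj F, isFamily_quad hinj F',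
    fun hp => hF (trivialPerm_quad_iff hinj hp), ?_⟩
  simpa only [map_neg, map_add, toPlane_vec] using h

theorem isNonDegenerate_generations (hx : x ∉ degenerateSet N) :
    IsNonDegenerate (generations x) := by
  have hinj := position_injective hx
  intro l hl h1 h5 h0
  obtain ⟨m, rfl⟩ := exists_toPlane_eq hinj hl
  rw [mass_toPlane hinj] at h1
  rw [size_toPlane hinj] at h5
  obtain ⟨u, n, h⟩ := exists_familySum_of_notMem hx h1 h5
    (by rw [defect_eq hinj, h0, Complex.ofReal_zero])
  have hmem : ∀ u, position x u ∈ allPoints (generations x) := fun u => by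
    rw [allPoints_generations]; exact ⟨u, rfl⟩
  rcases unitForm_of_eq h h5 with ⟨u, h⟩ | ⟨F, b, h⟩ | ⟨F, b, h⟩ | ⟨u, F, hs, h⟩ |
    ⟨u, F, F', hF, hs, hs', h⟩
  · left
    rw [size_toPlane hinj, h, absSize_single, abs_one]
  · right; left
    obtain ⟨e1, e2, e3⟩ := size_support_pos_single_add_single_sub_single (hinj.ne F.parent_ne)
      (hinj.ne (F.parent_ne_child F le_rfl false b)) (hinj.ne (F.parent_ne_child F le_rfl true b))
    simp only [h, map_add, map_sub, toPlane_single]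
    refine ⟨e1, F.1, quad x F, isFamily_quad hinj F, ?_, ?_, .inl e3⟩
    · rw [e2]
      have := mem_points_child x F b
      simp only [Finset.coe_insert, Finset.coe_singleton, Set.insert_subset_iff,
        Set.singleton_subset_iff]
      exact ⟨mem_points_parent x F _, mem_points_parent x F _, this⟩
    · rw [e2, Finset.card_eq_three]
      exact ⟨_, _, _, hinj.ne F.parent_ne, hinj.ne (F.parent_ne_child F le_rfl false b),
        hinj.ne (F.parent_ne_child F le_rfl true b), rfl⟩
  · right; left
    have n1 := hinj.ne F.child_ne
    have n2 := hinj.ne (F.parent_ne_child F le_rfl b false).symm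
    have n3 := hinj.ne (F.parent_ne_child F le_rfl b true).symm
    obtain ⟨e1, e2, e3⟩ := size_support_pos_single_add_single_sub_single n1 n2 n3
    simp only [h, map_add, map_sub, toPlane_single]
    refine ⟨e1, F.1, quad x F, isFamily_quad hinj F, ?_, ?_, .inr e3⟩
    · rw [e2]
      simp only [Finset.coe_insert, Finset.coe_singleton, Set.insert_subset_iff,
        Set.singleton_subset_iff]
      exact ⟨mem_points_child x F _, mem_points_child x F _, mem_points_parent x F b⟩
    · rw [e2, Finset.card_eq_three]
      exact ⟨_, _, _, n1, n2, n3, rfl⟩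
  · right; right; left
    refine ⟨by rw [size_toPlane hinj]; omega, toPlane x (m - Pi.single u 1),
      ⟨F.1, quad x F, isFamily_quad hinj F, ?_⟩, position x u, hmem u, ?_⟩
    · rw [← toPlane_vec, ← map_neg]
      rcases h with h | h
      · left; rw [h, add_sub_cancel_right]
      · right; rw [h, add_sub_cancel_right]
    · rw [← toPlane_single, ← map_add, sub_add_cancel]
  · right; right; right
    refine ⟨by rw [size_toPlane hinj]; omega, position x u, hmem u, ?_⟩
    rw [← toPlane_single, ← map_sub]
    obtain ⟨n', hn'⟩ : ∃ n', m - Pi.single u 1 = familySum n' := by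
      rcases h with h | h
      · exact ⟨Pi.single F 1 + Pi.single F' 1, by
          rw [familySum_add, familySum_single, familySum_single, h]⟩
      · exact ⟨-(Pi.single F 1 + Pi.single F' 1), by
          rw [familySum_neg, familySum_add, familySum_single, familySum_single, h]⟩
    refine isCF_of_eq hinj (isResonant_toPlane_of_eq hinj hn' ?_ hs') hF ?_
    · simp [h1]
    · rcases h with h | h
      · left; rw [h]
      · right; rw [h]

theorem isFamilyVector_or_isCF (hx : x ∉ degenerateSet N) {l : ℂ →₀ ℤ}
    (hl : IsResonant (generations x) l) (h0 : l ≠ 0) :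
    IsFamilyVector (generations x) l ∨ IsCF (generations x) l := by
  have hinj := position_injective hx
  obtain ⟨m, rfl⟩ := exists_toPlane_eq hinj hl.support_subset
  have h6 : absSize m ≤ 6 := by rw [← size_toPlane hinj]; exact hl.size_le
  obtain ⟨n, rfl⟩ := eq_familySum_of_resonant hx (by rw [← mass_toPlane hinj]; exact hl.mass_eq)
    h6 (by rw [← momentum_toPlane hinj]; exact hl.momentum_eq)
    (by rw [← energy_toPlane hinj, hl.energy_eq, Complex.ofReal_zero])
  rcases familySum_cases h6 with h | ⟨F, h⟩ | ⟨-, F, F', hF, h⟩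
  · rw [h, map_zero] at h0
    exact absurd rfl h0
  · left
    refine ⟨F.1, quad x F, isFamily_quad hinj F, ?_⟩
    rw [← toPlane_vec, ← map_neg]
    rcases h with h | h
    · left; rw [h]
    · right; rw [h]
  · right
    refine isCF_of_eq hinj hl hF ?_
    rcases h with h | h
    · left; rw [h]
    · right; rw [h]

end Generic

end GenSet

end

theorem mainTheorem4 (N : ℕ) (hN : 1 ≤ N) :
    ∃ D : Set (GenSet.Params N), IsClosed D ∧ MeasureTheory.volume D = 0 ∧
      ∀ x : GenSet.Params N, x ∉ D →
        Function.Injective (GenSet.position x) ∧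
        GenSet.IsGenerationSet (GenSet.generations x) ∧
        GenSet.IsNonDegenerate (GenSet.generations x) ∧
        ∀ l : ℂ →₀ ℤ, GenSet.IsResonant (GenSet.generations x) l → l ≠ 0 →
          GenSet.IsFamilyVector (GenSet.generations x) l ∨
          GenSet.IsCF (GenSet.generations x) l := by
  exact ⟨GenSet.degenerateSet N, GenSet.isClosed_degenerateSet, GenSet.volume_degenerateSet,
    fun _ hx => ⟨GenSet.position_injective hx, GenSet.isGenerationSet_generations hx,
      GenSet.isNonDegenerate_generations hx, fun _ hl h0 =>
        GenSet.isFamilyVector_or_isCF hx hl h0⟩⟩
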